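/- Let $G=(V,E)$ be a finite directed graph with $n=|V|$ vertices and $m=|E|$ edges of unit capacity, and let $s\in V$. For integers $\lambda,k\ge 1$, a subgraph $H=(V,E_H)$ with $E_H\subseteq E$ is a $(\lambda,k)$-fault-tolerant bounded-flow-preserver ($(\lambda,k)$-FT-BFP) of $G$ if for every $F\subseteq E$ with $|F|\le k$ and every $t\in V$ the following holds, where $G-F$ and $H-F$ arise by deleting the edges in $F$ and $\mathrm{maxflow}(s,t,\cdot)$ is the maximum value of a flow from $s$ to $t$: if $\mathrm{maxflow}(s,t,G-F)\le\lambda$, then $\mathrm{maxflow}(s,t,H-F)=\mathrm{maxflow}(s,t,G-F)$; otherwise $\mathrm{maxflow}(s,t,H-F)\ge\lambda$. There is one algorithm that, given any finite directed graph $G$ (as a list of its edges), any source $s$ and any integers $\lambda,k\ge 1$, computes a $(\lambda,k)$-FT-BFP $H$ of $G$ in which every vertex has in-degree at most $2^k\lambda$, so that $H$ has at most $\lambda 2^k n$ edges. The algorithm runs in $O(\lambda 2^k mn+1)$ time, with an absolute constant, on a word RAM with words of $O(\log(n+m+\lambda+k))$ bits. In particular, such an $H$ always exists. -/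

import Mathlib

/-! ### Directed graphs, maximum flows and fault-tolerant bounded-flow-preservers -/

namespace Digraph

open Classical in
/-- The edge set of a finite directed graph. -/
noncomputable def edges {V : Type*} [Fintype V] (G : Digraph V) : Finset (V × V) :=
  Finset.univ.filter fun e => G.Adj e.1 e.2

open Classical in
/-- The in-degree of a vertex: the number of its in-neighbours. -/
noncomputable def inDegree {V : Type*} [Fintype V] (G : Digraph V) (v : V) : ℕ :=
  (Finset.univ.filter fun u => G.Adj u v).card

/-- The graph obtained from `G` by deleting the edges that lie in `F`. -/
def deleteEdges {V : Type*} (G : Digraph V) (F : Finset (V × V)) : Digraph V where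
  Adj u v := G.Adj u v ∧ (u, v) ∉ F

/-- The net amount that `f` sends out of the vertex `v`. -/
def netOut {V : Type*} [Fintype V] (f : V → V → ℝ) (v : V) : ℝ :=
  ∑ w, f v w - ∑ w, f w v

/-- `f` is a flow from `s` to `t` in `G`, every edge of `G` having capacity one. -/
structure IsFlow {V : Type*} [Fintype V] (G : Digraph V) (s t : V) (f : V → V → ℝ) : Prop where
  nonneg : ∀ u v, 0 ≤ f u v
  le_one : ∀ u v, f u v ≤ 1
  support : ∀ u v, ¬ G.Adj u v → f u v = 0
  conservation : ∀ v, v ≠ s → v ≠ t → netOut f v = 0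

/-- The values of the flows from `s` to `t` in `G`. -/
def flowValues {V : Type*} [Fintype V] (G : Digraph V) (s t : V) : Set ℝ :=
  {x | ∃ f, IsFlow G s t f ∧ netOut f s = x}

/-- The maximum value of a flow from `s` to `t` in `G`. -/
noncomputable def maxFlow {V : Type*} [Fintype V] (G : Digraph V) (s t : V) : ℝ :=
  sSup (flowValues G s t)

/-- The set of flow values is non-empty, so that its supremum is meaningful. -/
theorem flowValues_nonempty {V : Type*} [Fintype V] (G : Digraph V) (s t : V) :
    (flowValues G s t).Nonempty :=
  ⟨0, fun _ _ => 0, ⟨by simp, by simp, by simp, by simp [netOut]⟩, by simp [netOut]⟩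

/-- The set of flow values is bounded above, so that its supremum is meaningful. -/
theorem flowValues_bddAbove {V : Type*} [Fintype V] (G : Digraph V) (s t : V) :
    BddAbove (flowValues G s t) := by
  refine ⟨Fintype.card V, ?_⟩
  rintro x ⟨f, hf, rfl⟩
  have h1 : ∑ w, f s w ≤ ∑ _w : V, (1 : ℝ) := Finset.sum_le_sum fun w _ => hf.le_one s w
  have h2 : 0 ≤ ∑ w, f w s := Finset.sum_nonneg fun w _ => hf.nonneg w s
  simp only [Finset.sum_const, Finset.card_univ, nsmul_eq_mul, mul_one] at h1
  unfold netOut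
  linarith

/-- `H` is a `(lam, k)`-fault-tolerant bounded-flow-preserver of `G` for the source `s`. -/
def IsFTBFP {V : Type*} [Fintype V] (lam k : ℕ) (G : Digraph V) (s : V) (H : Digraph V) : Prop :=
  H ≤ G ∧
    ∀ F : Finset (V × V), F ⊆ edges G → F.card ≤ k → ∀ t : V,
      (maxFlow (deleteEdges G F) s t ≤ lam →
        maxFlow (deleteEdges H F) s t = maxFlow (deleteEdges G F) s t) ∧
      ((lam : ℝ) < maxFlow (deleteEdges G F) s t →
        (lam : ℝ) ≤ maxFlow (deleteEdges H F) s t)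

end Digraph

/-! ### A word RAM with a step count

Programs are structured, with finitely many registers and arrays of natural numbers. Every
operation on words, every read, every write and every test takes one step. All words that occur in
a run have to be smaller than a bound `W`; a run that would exceed it has no result. -/

namespace WordRAM

/-- A memory state: registers, and arrays (array number, then index). -/
structure State where
  reg : ℕ → ℕ
  mem : ℕ → ℕ → ℕ

/-- Operations on words; `sub` is truncated at zero, a comparison yields one or zero. -/
inductive Op where
  | add
  | sub
  | mul
  | div
  | lt
  | eq

/-- The result of an operation. -/
def Op.app : Op → ℕ → ℕ → ℕ
  | .add, x, y => x + y
  | .sub, x, y => x - y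
  | .mul, x, y => x * y
  | .div, x, y => x / y
  | .lt, x, y => if x < y then 1 else 0
  | .eq, x, y => if x = y then 1 else 0

/-- Expressions: constants, registers, array entries and operations. -/
inductive Expr where
  | const (c : ℕ)
  | reg (x : ℕ)
  | get (a : ℕ) (i : Expr)
  | op (o : Op) (e₁ e₂ : Expr)

/-- The value of an expression. -/
def Expr.eval (σ : State) : Expr → ℕ
  | .const c => c
  | .reg x => σ.reg x
  | .get a i => σ.mem a (i.eval σ)
  | .op o e₁ e₂ => o.app (e₁.eval σ) (e₂.eval σ)

/-- The values of an expression and of all its subexpressions are smaller than `W`. -/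
def Expr.Fits (W : ℕ) (σ : State) : Expr → Prop
  | .const c => c < W
  | .reg x => σ.reg x < W
  | .get a i => i.Fits W σ ∧ σ.mem a (i.eval σ) < W
  | .op o e₁ e₂ => e₁.Fits W σ ∧ e₂.Fits W σ ∧ o.app (e₁.eval σ) (e₂.eval σ) < W

/-- The number of steps that the evaluation of an expression takes. -/
def Expr.cost : Expr → ℕ
  | .const _ => 1
  | .reg _ => 1
  | .get _ i => i.cost + 1
  | .op _ e₁ e₂ => e₁.cost + e₂.cost + 1

/-- Programs. A test succeeds if its value is not zero. -/
inductive Program where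
  | skip
  | assign (x : ℕ) (e : Expr)
  | store (a : ℕ) (i e : Expr)
  | seq (P Q : Program)
  | ite (b : Expr) (P Q : Program)
  | loop (b : Expr) (P : Program)

/-- The state after writing `y` to register `x`. -/
def State.setReg (σ : State) (x y : ℕ) : State where
  reg := Function.update σ.reg x y
  mem := σ.mem

/-- The state after writing `y` to position `i` of array `a`. -/
def State.setMem (σ : State) (a i y : ℕ) : State where
  reg := σ.reg
  mem := Function.update σ.mem a (Function.update (σ.mem a) i y)

/-- `Exec W P σ τ T`: started in state `σ` on words smaller than `W`, the program `P` halts in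
state `τ` after `T` steps. -/
inductive Exec (W : ℕ) : Program → State → State → ℕ → Prop where
  | skip (σ : State) : Exec W .skip σ σ 1
  | assign (σ : State) (x : ℕ) (e : Expr) (he : e.Fits W σ) :
      Exec W (.assign x e) σ (σ.setReg x (e.eval σ)) (e.cost + 1)
  | store (σ : State) (a : ℕ) (i e : Expr) (hi : i.Fits W σ) (he : e.Fits W σ) :
      Exec W (.store a i e) σ (σ.setMem a (i.eval σ) (e.eval σ)) (i.cost + e.cost + 1)
  | seq {P Q : Program} {σ τ ρ : State} {T U : ℕ} (hP : Exec W P σ τ T) (hQ : Exec W Q τ ρ U) :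
      Exec W (.seq P Q) σ ρ (T + U)
  | ite_true {b : Expr} {P Q : Program} {σ τ : State} {T : ℕ} (hb : b.Fits W σ)
      (h : b.eval σ ≠ 0) (hP : Exec W P σ τ T) : Exec W (.ite b P Q) σ τ (b.cost + 1 + T)
  | ite_false {b : Expr} {P Q : Program} {σ τ : State} {T : ℕ} (hb : b.Fits W σ)
      (h : b.eval σ = 0) (hQ : Exec W Q σ τ T) : Exec W (.ite b P Q) σ τ (b.cost + 1 + T)
  | loop_false {b : Expr} {P : Program} {σ : State} (hb : b.Fits W σ) (h : b.eval σ = 0) :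
      Exec W (.loop b P) σ σ (b.cost + 1)
  | loop_true {b : Expr} {P : Program} {σ τ ρ : State} {T U : ℕ} (hb : b.Fits W σ)
      (h : b.eval σ ≠ 0) (hP : Exec W P σ τ T) (hL : Exec W (.loop b P) τ ρ U) :
      Exec W (.loop b P) σ ρ (b.cost + 1 + T + U)

/-- The input for the graph `G` with source `s` and the numbers `lam` and `k`: the registers
`0, …, 4` hold the number `n` of vertices, the number `m` of edges, the source, `lam` and `k`, and
the arrays `0` and `1` hold the tails and the heads of the edges. Vertices are numbered from `0` to
`n - 1` by `vtx`, and edges from `0` to `m - 1` by `edg`. Everything else is zero. -/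
noncomputable def inputState {V : Type*} [Fintype V] (G : Digraph V) (s : V) (lam k : ℕ)
    (vtx : V ≃ Fin (Fintype.card V)) (edg : Fin G.edges.card ≃ G.edges) : State where
  reg x := match x with
    | 0 => Fintype.card V
    | 1 => G.edges.card
    | 2 => vtx s
    | 3 => lam
    | 4 => k
    | _ => 0
  mem a i := if h : i < G.edges.card then
      match a with
      | 0 => vtx (edg ⟨i, h⟩).1.1
      | 1 => vtx (edg ⟨i, h⟩).1.2
      | _ => 0
    else 0

/-- The output: the spanning subgraph whose edges are the edges of `G` that are marked by a non-zero
entry in array `2`. -/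
def outputGraph {V : Type*} [Fintype V] (G : Digraph V)
    (edg : Fin G.edges.card ≃ G.edges) (τ : State) : Digraph V where
  Adj u v := ∃ i : Fin G.edges.card, (edg i).1 = (u, v) ∧ τ.mem 2 i ≠ 0

end WordRAM

/-!
Flows from `s` are compared through cuts. Give the edges unit capacities and add a vertex `n` with an
edge of capacity `lam` to `s`; cuts around `n` then have the values of the cuts around `s`, capped at
`lam`. By the max-flow min-cut theorem (`Digraph.exists_cutSize_eq_maxFlow`) it suffices that for
every set `F` of at most `k` deleted edges and every cut `X` around `n`, some cut `X' ⊆ X` is at most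
as large in `G - F` as `X` is in `H - F` (`Network.Preserves`). Since `X'` lies inside `X`, it
separates `n` from whatever `X` does. This makes the relation transitive, so the vertices `t` can be
treated one after the other, each time deleting some of the edges that enter `t`.

For one vertex `t`, start with the source set `{n}` and repeat `k` times: replace the source set by
its farthest minimum cut `A` towards `t`, and double the capacities of the edges that leave `A`,
except for those that enter `t` (`Network.Doubling`). Finally compute a maximum flow once more and
keep, of the edges that enter `t`, those that carry flow. Each doubling at most doubles the minimum
cut, so at most `lam * 2 ^ k` edges are kept.

To see that this preserves cuts (`Network.Doubling.preserves`), let `t ∉ X`. Edges from the cuts `A`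
to `t` are saturated by the flow, so none of them is deleted. If for one of the cuts `A` no edge
leads from `X ∩ A` to `X \ A`, then `X' = X ∩ A` works. Otherwise every round has an edge
of this kind, and it is doubled. Going back through the rounds with submodularity, each such edge
makes the cut `X ∪ A₁` in `H` exceed the first minimum cut `A₁` by one more unit, so in the end by
`k` units (`Network.Doubling.separated_or_surplus`). As `F` takes away at most `k` units, the
submodularity inequality for `X` and `A₁` in `H - F` gives the claim for `X' = X ∩ A₁`.

The program keeps the residual capacities in arrays and finds augmenting paths by a backward search
from `t` (`Residual.Search`). A search that misses the source set has found the complement of the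
farthest minimum cut (`Network.isFarthestMinCut_compl`), which starts the next round. The flow of one
round remains a flow after the doubling, so all rounds for `t` take at most `lam * 2 ^ k`
augmentations and `k + 1` failing searches, each in time `O(m)`. The running time and the absence of
overflow are derived in a program logic (`WordRAM.Run`) that bounds costs along with the
postconditions, with weakest preconditions for straight-line code (`WordRAM.Run.of_wp`).
-/

/-! ### Cuts of capacitated networks -/

/-- A finite directed multigraph, given by the tails and the heads of its edges. -/
structure Network (ι V : Type*) where
  edges : Finset ι
  tail : ι → V
  head : ι → V

namespace Network

variable {ι V : Type*} (N : Network ι V)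

open Classical in
/-- The capacity, under `c`, of the edges that leave the vertex set `A`. -/
noncomputable def cut (c : ι → ℕ) (A : Set V) : ℕ :=
  ∑ e ∈ N.edges, if N.tail e ∈ A ∧ N.head e ∉ A then c e else 0

theorem cut_union_add_cut_inter_le (c : ι → ℕ) (A B : Set V) :
    N.cut c (A ∪ B) + N.cut c (A ∩ B) ≤ N.cut c A + N.cut c B := by
  classical
  unfold cut
  rw [← Finset.sum_add_distrib, ← Finset.sum_add_distrib]
  refine Finset.sum_le_sum fun e _ => ?_
  by_cases h1 : N.tail e ∈ A <;> by_cases h2 : N.tail e ∈ B <;>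
    by_cases h3 : N.head e ∈ A <;> by_cases h4 : N.head e ∈ B <;> simp [h1, h2, h3, h4]

theorem cut_congr {c d : ι → ℕ} {A : Set V}
    (h : ∀ e ∈ N.edges, N.tail e ∈ A → N.head e ∉ A → c e = d e) : N.cut c A = N.cut d A := by
  classical
  unfold cut
  refine Finset.sum_congr rfl fun e he => ?_
  split_ifs with hA
  · exact h e he hA.1 hA.2
  · rfl

theorem cut_mono {c d : ι → ℕ} {A B : Set V}
    (h : ∀ e ∈ N.edges, N.tail e ∈ A → N.head e ∉ A → 0 < c e →
      N.tail e ∈ B ∧ N.head e ∉ B ∧ c e ≤ d e) : N.cut c A ≤ N.cut d B := by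
  classical
  unfold cut
  refine Finset.sum_le_sum fun e he => ?_
  by_cases hA : N.tail e ∈ A ∧ N.head e ∉ A
  · rcases Nat.eq_zero_or_pos (c e) with h0 | h0
    · simp [h0]
    · obtain ⟨h1, h2, h3⟩ := h e he hA.1 hA.2 h0
      simpa [hA.1, hA.2, h1, h2] using h3
  · simp [hA]

open Classical in
/-- The capacities that remain after the deletion of the edges in `F`. -/
noncomputable def del (F : Finset ι) (c : ι → ℕ) (e : ι) : ℕ := if e ∈ F then 0 else c e

theorem cut_le_cut_del_add_card {F : Finset ι} {c : ι → ℕ} (hF : ∀ e ∈ F, c e ≤ 1) (A : Set V) :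
    N.cut c A ≤ N.cut (del F c) A + F.card := by
  classical
  have h1 : (∑ e ∈ N.edges, if e ∈ F then 1 else 0) ≤ F.card := by
    rw [← Finset.sum_filter, Finset.sum_const, smul_eq_mul, mul_one]
    exact Finset.card_le_card fun e he => (Finset.mem_filter.1 he).2
  refine le_trans ?_ (Nat.add_le_add_left h1 _)
  unfold cut del
  rw [← Finset.sum_add_distrib]
  refine Finset.sum_le_sum fun e _ => ?_
  by_cases heF : e ∈ F
  · have := hF e heF
    simp only [heF, if_true]
    split_ifs <;> omega
  · simp [heF]

/-- `A` is the largest minimum cut between the source set `S` and `t`: every vertex set that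
contains `S` and avoids `t` has at least the cut value of `A`, and a strictly larger one if it is
not contained in `A`. -/
structure IsFarthestMinCut (u : ι → ℕ) (S : Set V) (t : V) (A : Set V) : Prop where
  subset : S ⊆ A
  notMem : t ∉ A
  le : ∀ Z, S ⊆ Z → t ∉ Z → N.cut u A ≤ N.cut u Z
  lt : ∀ Z, S ⊆ Z → t ∉ Z → ¬ Z ⊆ A → N.cut u A < N.cut u Z

/-- `N.Doubling c r t j S u`: the source set `S` and the capacities `u` arise from `{r}` and `c` in
`j` rounds. A round replaces the source set by its farthest minimum cut towards `t`, and doubles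
the capacities of the edges of this cut that do not enter `t`. -/
inductive Doubling (c : ι → ℕ) (r t : V) : ℕ → Set V → (ι → ℕ) → Prop
  | zero : Doubling c r t 0 {r} c
  | succ {j : ℕ} {S A : Set V} {u u' : ι → ℕ} (h : Doubling c r t j S u)
      (hA : N.IsFarthestMinCut u S t A)
      (h₂ : ∀ e ∈ N.edges, N.tail e ∈ A → N.head e ∉ A → N.head e ≠ t → u' e = 2 * u e)
      (h₁ : ∀ e ∈ N.edges, ¬ (N.tail e ∈ A ∧ N.head e ∉ A ∧ N.head e ≠ t) → u' e = u e) :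
      Doubling c r t (j + 1) A u'

namespace Doubling

variable {N} {c : ι → ℕ} {r t : V} {j : ℕ} {S : Set V} {u : ι → ℕ}

theorem mem (h : N.Doubling c r t j S u) : r ∈ S := by
  induction h with
  | zero => rfl
  | succ _ hA _ _ ih => exact hA.subset ih

theorem notMem (h : N.Doubling c r t j S u) (hrt : r ≠ t) : t ∉ S := by
  cases h with
  | zero => simpa using hrt.symm
  | succ _ hA => exact hA.notMem

theorem le (h : N.Doubling c r t j S u) : ∀ e ∈ N.edges, c e ≤ u e := by
  induction h with
  | zero => exact fun _ _ => le_rfl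
  | @succ j S A u u' _ hA h₂ h₁ ih =>
    intro e he
    by_cases hc : N.tail e ∈ A ∧ N.head e ∉ A ∧ N.head e ≠ t
    · rw [h₂ e he hc.1 hc.2.1 hc.2.2]
      have := ih e he
      omega
    · rw [h₁ e he hc]
      exact ih e he

theorem eq_of_head_eq (h : N.Doubling c r t j S u) : ∀ e ∈ N.edges, N.head e = t → u e = c e := by
  induction h with
  | zero => exact fun _ _ _ => rfl
  | succ _ hA h₂ h₁ ih =>
    intro e he het
    rw [h₁ e he fun hc => hc.2.2 het]
    exact ih e he het

end Doubling

open Classical in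
/-- The capacities `u`, with those of the edges that enter `t` replaced by `c'`. -/
noncomputable def replaceIn (t : V) (c' u : ι → ℕ) (e : ι) : ℕ := if N.head e = t then c' e else u e

/-- The counting argument behind the preserver. Going back through the rounds, either in one of
them no edge leads from `X ∩ A'` to `X \ A'`, or every round contributes one more unit to the
surplus of the cut `X ∪ A'` over the minimum cut `A'`. -/
theorem Doubling.separated_or_surplus {c c' : ι → ℕ} {r t : V} {W X : Set V}
    (hW : ∀ e ∈ N.edges, N.tail e ∈ W → N.head e = t → c' e = c e)
    (htX : t ∉ X) {j : ℕ} {S : Set V} {u : ι → ℕ} (h : N.Doubling c r t j S u) :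
    ∀ (A : Set V) (d : ℕ), S ⊆ A → t ∉ A → A ⊆ W →
      N.cut u A + d ≤ N.cut (N.replaceIn t c' u) (X ∪ A) →
      (∃ A' ⊆ W, r ∈ A' ∧ ∀ e ∈ N.edges, 0 < c e → N.tail e ∈ X → N.tail e ∈ A' →
        N.head e ∈ X → N.head e ∈ A') ∨
      ∃ A' ⊆ W, r ∈ A' ∧ N.cut c A' + d + j ≤ N.cut (N.replaceIn t c' c) (X ∪ A') := by
  classical
  induction h with
  | zero => exact fun A d hSA _ hAW hd => Or.inr ⟨A, hAW, hSA rfl, hd⟩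
  | @succ j S A₀ u u' hj hA₀ h₂ h₁ ih =>
    intro A d hSA htA hAW hd
    by_cases hsep : ∀ e ∈ N.edges, 0 < c e → N.tail e ∈ X → N.tail e ∈ A₀ →
        N.head e ∈ X → N.head e ∈ A₀
    · exact Or.inl ⟨A₀, hSA.trans hAW, hA₀.subset hj.mem, hsep⟩
    push Not at hsep
    obtain ⟨e₀, he₀, hc₀, htlX, htlA, hhdX, hhdA⟩ := hsep
    have hu₀ : 0 < u e₀ := lt_of_lt_of_le hc₀ (hj.le e₀ he₀)
    have hcut : ∀ Y, Y ⊆ W → N.cut (N.replaceIn t c' u) Y = N.cut u Y := fun Y hY =>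
      N.cut_congr fun e he h1 _ => by
        unfold replaceIn
        split_ifs with h3
        · rw [hW e he (hY h1) h3, hj.eq_of_head_eq e he h3]
        · rfl
    -- The doubled edges leaving `X ∪ A` also leave `A`; `e₀` leaves at most `A`.
    have hdouble : N.cut (N.replaceIn t c' u') (X ∪ A) + N.cut u A +
        (if N.head e₀ ∈ A then 0 else 1) ≤
        N.cut (N.replaceIn t c' u) (X ∪ A) + N.cut u' A := by
      have hone : (if N.head e₀ ∈ A then 0 else 1) =
          ∑ e ∈ N.edges, if e = e₀ then (if N.head e₀ ∈ A then 0 else 1) else 0 := by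
        rw [Finset.sum_ite_eq' N.edges e₀, if_pos he₀]
      rw [hone]
      unfold cut
      rw [← Finset.sum_add_distrib, ← Finset.sum_add_distrib, ← Finset.sum_add_distrib]
      refine Finset.sum_le_sum fun e he => ?_
      by_cases hee : e = e₀
      · subst hee
        have h3 := h₂ e he htlA hhdA (fun h => htX (h ▸ hhdX))
        have h4 : N.tail e ∈ A := hSA htlA
        by_cases h5 : N.head e ∈ A
        · simp [h4, h5, hhdX]
        · simp only [Set.mem_union, htlX, hhdX, h4, h5, if_true, if_false]
          simp only [not_true, true_or, and_false, if_false, not_false_eq_true, and_self, if_true]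
          omega
      · simp only [hee, if_false, add_zero]
        by_cases hc : N.tail e ∈ A₀ ∧ N.head e ∉ A₀ ∧ N.head e ≠ t
        · have h3 := h₂ e he hc.1 hc.2.1 hc.2.2
          have h4 : N.tail e ∈ A := hSA hc.1
          simp only [replaceIn, hc.2.2, if_false, Set.mem_union, h4, or_true, true_and, h3]
          by_cases h5 : N.head e ∈ X <;> by_cases h6 : N.head e ∈ A <;> simp [h5, h6] <;> omega
        · rw [show N.replaceIn t c' u' e = N.replaceIn t c' u e by
            simp only [replaceIn, h₁ e he hc], h₁ e he hc]
    have hsub := N.cut_union_add_cut_inter_le (N.replaceIn t c' u) (X ∪ A₀) A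
    rw [Set.union_assoc, Set.union_eq_self_of_subset_left hSA, hcut A hAW,
      hcut _ (Set.inter_subset_right.trans hAW)] at hsub
    have hSi : S ⊆ (X ∪ A₀) ∩ A :=
      fun v hv => ⟨Or.inr (hA₀.subset hv), hSA (hA₀.subset hv)⟩
    have hinter : N.cut u A₀ + (if N.head e₀ ∈ A then 1 else 0) ≤ N.cut u ((X ∪ A₀) ∩ A) := by
      split_ifs with h5
      · exact hA₀.lt _ hSi (fun h => htA h.2) fun h => hhdA (h ⟨Or.inl hhdX, h5⟩)
      · exact hA₀.le _ hSi fun h => htA h.2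
    have hnew : N.cut u A₀ + (d + 1) ≤ N.cut (N.replaceIn t c' u) (X ∪ A₀) := by
      split_ifs at hdouble hinter <;> omega
    rcases ih A₀ (d + 1) hA₀.subset hA₀.notMem (hSA.trans hAW) hnew with h | ⟨A', h1, h2, h3⟩
    · exact Or.inl h
    · exact Or.inr ⟨A', h1, h2, by omega⟩

/-- Passing from `c` to the smaller capacities `c'`, no deletion of at most `k` edges of capacity at
most one creates a cut around `r` that is smaller under `c'` than all cuts under `c` that lie inside
it. As the cut for `c` lies inside the cut for `c'`, it separates `r` from the same targets. -/
structure Preserves (r : V) (k : ℕ) (c c' : ι → ℕ) : Prop where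
  le : ∀ e ∈ N.edges, c' e ≤ c e
  exists_cut_le : ∀ F ⊆ N.edges, (∀ e ∈ F, c e ≤ 1) → F.card ≤ k → ∀ X : Set V, r ∈ X →
    ∃ X' ⊆ X, r ∈ X' ∧ N.cut (del F c) X' ≤ N.cut (del F c') X

variable {N} in
theorem Preserves.trans {r : V} {k : ℕ} {c c' c'' : ι → ℕ} (h : N.Preserves r k c c')
    (h' : N.Preserves r k c' c'') : N.Preserves r k c c'' := by
  refine ⟨fun e he => (h'.le e he).trans (h.le e he), fun F hFE hF hk X hX => ?_⟩
  obtain ⟨Y, hYX, hY, hle⟩ :=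
    h'.exists_cut_le F hFE (fun e he => (h.le e (hFE he)).trans (hF e he)) hk X hX
  obtain ⟨Z, hZY, hZ, hle'⟩ := h.exists_cut_le F hFE hF hk Y hY
  exact ⟨Z, hZY.trans hYX, hZ, hle'.trans hle⟩

variable {N} in
theorem Preserves.refl (r : V) (k : ℕ) (c : ι → ℕ) : N.Preserves r k c c :=
  ⟨fun _ _ => le_rfl, fun _ _ _ _ X hX => ⟨X, subset_rfl, hX, le_rfl⟩⟩

/-- After `k` rounds of doubling it suffices to keep, of the edges that enter `t`, those which a
maximum flow of the last round uses. -/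
theorem Doubling.preserves {c c' : ι → ℕ} {r t : V} {k : ℕ} {S A : Set V} {u : ι → ℕ}
    (h : N.Doubling c r t k S u) (hA : N.IsFarthestMinCut u S t A)
    (hle : ∀ e ∈ N.edges, c' e ≤ c e) (hne : ∀ e ∈ N.edges, N.head e ≠ t → c' e = c e)
    (hAt : ∀ e ∈ N.edges, N.tail e ∈ A → N.head e = t → c' e = c e)
    (hflow : ∀ Z, S ⊆ Z → t ∉ Z → N.cut u A ≤ N.cut (N.replaceIn t c' u) Z) :
    N.Preserves r k c c' := by
  refine ⟨hle, fun F hFE hF hFk X hrX => ?_⟩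
  classical
  by_cases htX : t ∈ X
  · refine ⟨X, subset_rfl, hrX, (N.cut_congr fun e he _ h2 => ?_).le⟩
    simp only [del, hne e he (fun h => h2 (h ▸ htX))]
  have hbase := hflow (X ∪ A) (hA.subset.trans Set.subset_union_right)
    (fun h => h.elim htX hA.notMem)
  rcases h.separated_or_surplus N hAt htX A 0 hA.subset hA.notMem subset_rfl hbase with
    ⟨A', hA', hr, hsep⟩ | ⟨A', hA', hr, hsur⟩
  · refine ⟨X ∩ A', Set.inter_subset_left, ⟨hrX, hr⟩, N.cut_mono fun e he h1 h2 h3 => ?_⟩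
    have hc : 0 < c e := by
      unfold del at h3
      split_ifs at h3
      · omega
      · exact h3
    refine ⟨h1.1, fun h4 => h2 ⟨h4, hsep e he hc h1.1 h1.2 h4⟩, ?_⟩
    by_cases h4 : N.head e = t
    · simp [del, hAt e he (hA' h1.2) h4]
    · simp [del, hne e he h4]
  · refine ⟨X ∩ A', Set.inter_subset_left, ⟨hrX, hr⟩, ?_⟩
    have h1 := N.cut_union_add_cut_inter_le (del F c') X A'
    have h2 := N.cut_le_cut_del_add_card (c := c')
      (fun e he => (hle e (hFE he)).trans (hF e he)) (X ∪ A')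
    have h3 : N.cut (N.replaceIn t c' c) (X ∪ A') = N.cut c' (X ∪ A') :=
      N.cut_congr fun e he _ _ => by
        unfold replaceIn
        split_ifs with h4
        · rfl
        · exact (hne e he h4).symm
    have h4 : N.cut (del F c') A' ≤ N.cut c A' := N.cut_mono fun e he h5 h6 _ => by
      refine ⟨h5, h6, ?_⟩
      unfold del
      split_ifs
      · exact Nat.zero_le _
      · exact hle e he
    have h5 : N.cut (del F c) (X ∩ A') = N.cut (del F c') (X ∩ A') :=
      N.cut_congr fun e he h6 _ => by
        by_cases h4 : N.head e = t
        · simp [del, hAt e he (hA' h6.2) h4]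
        · simp [del, hne e he h4]
    omega

/-! ### Flows and residual reachability -/

/-- The amount of the flow `g` that arrives at `v`, less the amount that leaves `v`. -/
noncomputable def excess [DecidableEq V] (g : ι → ℕ) (v : V) : ℤ :=
  ∑ e ∈ N.edges, ((if N.head e = v then (g e : ℤ) else 0) - if N.tail e = v then (g e : ℤ) else 0)

variable [DecidableEq V]

open Classical in
theorem excess_eq_of_conservation {g : ι → ℕ} {S Z : Set V} {t : V}
    (hg : ∀ v, v ∉ S → v ≠ t → N.excess g v = 0) (hSZ : S ⊆ Z) (htZ : t ∉ Z) :
    N.excess g t = ∑ e ∈ N.edges, ((if N.tail e ∈ Z ∧ N.head e ∉ Z then (g e : ℤ) else 0) -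
      if N.tail e ∉ Z ∧ N.head e ∈ Z then (g e : ℤ) else 0) := by
  set U : Finset V := (insert t (N.edges.image N.head ∪ N.edges.image N.tail)).filter (· ∉ Z)
    with hU
  have h1 : ∑ v ∈ U, N.excess g v = N.excess g t := by
    refine Finset.sum_eq_single t (fun v hv hvt => hg v (fun h => ?_) hvt) fun h => ?_
    · exact (Finset.mem_filter.1 hv).2 (hSZ h)
    · exact absurd (by simp [hU, htZ]) h
  rw [← h1]
  unfold excess
  rw [Finset.sum_comm]
  refine Finset.sum_congr rfl fun e he => ?_
  have hh : N.head e ∈ U ↔ N.head e ∉ Z := by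
    simp only [hU, Finset.mem_filter, Finset.mem_insert, Finset.mem_union, and_iff_right_iff_imp]
    exact fun _ => Or.inr (Or.inl (Finset.mem_image_of_mem _ he))
  have ht : N.tail e ∈ U ↔ N.tail e ∉ Z := by
    simp only [hU, Finset.mem_filter, Finset.mem_insert, Finset.mem_union, and_iff_right_iff_imp]
    exact fun _ => Or.inr (Or.inr (Finset.mem_image_of_mem _ he))
  rw [Finset.sum_sub_distrib, Finset.sum_ite_eq, Finset.sum_ite_eq]
  simp only [hh, ht]
  by_cases h3 : N.tail e ∈ Z <;> by_cases h4 : N.head e ∈ Z <;> simp [h3, h4]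

theorem excess_le_cut {g u : ι → ℕ} {S Z : Set V} {t : V}
    (hg : ∀ v, v ∉ S → v ≠ t → N.excess g v = 0) (hgu : ∀ e ∈ N.edges, g e ≤ u e)
    (hSZ : S ⊆ Z) (htZ : t ∉ Z) : N.excess g t ≤ N.cut u Z := by
  classical
  rw [N.excess_eq_of_conservation hg hSZ htZ, cut, Nat.cast_sum]
  refine Finset.sum_le_sum fun e he => ?_
  have := hgu e he
  split_ifs <;> push_cast <;> omega

/-- Let `B` be a set of vertices from which `t` can be reached in the residual network: `B` is
enumerated by `q`, beginning with `t`, and every other vertex of `B` has a residual arc to an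
earlier one. If `B` is closed under residual arcs and misses the source set, then the complement of
`B` is the farthest minimum cut. -/
theorem isFarthestMinCut_compl {g u : ι → ℕ} {S B : Set V} {t : V}
    (hg : ∀ v, v ∉ S → v ≠ t → N.excess g v = 0) (hgu : ∀ e ∈ N.edges, g e ≤ u e)
    (q : ℕ → V) (b : ℕ) (hB : ∀ v, v ∈ B ↔ ∃ i < b, q i = v) (hb : 0 < b) (hq : q 0 = t)
    (hreach : ∀ i < b, 0 < i → ∃ l < i, ∃ e ∈ N.edges,
      (N.tail e = q i ∧ N.head e = q l ∧ g e < u e) ∨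
      (N.head e = q i ∧ N.tail e = q l ∧ 0 < g e))
    (hfwd : ∀ e ∈ N.edges, N.head e ∈ B → g e < u e → N.tail e ∈ B)
    (hbwd : ∀ e ∈ N.edges, N.tail e ∈ B → 0 < g e → N.head e ∈ B) (hSB : ∀ v ∈ S, v ∉ B) :
    N.IsFarthestMinCut u S t Bᶜ ∧ (N.cut u Bᶜ : ℤ) = N.excess g t := by
  classical
  have htB : t ∉ Bᶜ := fun h => h ((hB t).2 ⟨0, hb, hq⟩)
  have hval : (N.cut u Bᶜ : ℤ) = N.excess g t := by
    rw [N.excess_eq_of_conservation hg (show S ⊆ Bᶜ from fun v hv => hSB v hv) htB, cut,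
      Nat.cast_sum]
    refine Finset.sum_congr rfl fun e he => ?_
    have h1 := hfwd e he
    have h2 := hbwd e he
    have h3 := hgu e he
    by_cases h4 : N.tail e ∈ B <;> by_cases h5 : N.head e ∈ B <;> simp [h4, h5] at h1 h2 ⊢ <;> omega
  refine ⟨⟨fun v hv => hSB v hv, htB, fun Z hSZ htZ => ?_, fun Z hSZ htZ hZ => ?_⟩, hval⟩
  · exact_mod_cast hval.trans_le (N.excess_le_cut hg hgu hSZ htZ)
  · obtain ⟨z, hzZ, hzB⟩ := Set.not_subset.1 hZ
    have hex : ∃ i, i < b ∧ q i ∈ Z := by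
      obtain ⟨i, hi, rfl⟩ := (hB z).1 (not_not.1 hzB)
      exact ⟨i, hi, hzZ⟩
    -- The first vertex of the enumeration that lies in `Z` has a residual arc that leaves `Z`.
    obtain ⟨hi, hiZ⟩ := Nat.find_spec hex
    have hpos : 0 < Nat.find hex := by
      refine Nat.pos_of_ne_zero fun h0 => htZ ?_
      rw [h0, hq] at hiZ
      exact hiZ
    obtain ⟨l, hl, e₀, he₀, hres⟩ := hreach _ hi hpos
    have hlZ : q l ∉ Z := fun h => Nat.find_min hex hl ⟨hl.trans hi, h⟩
    have hlt : N.excess g t < N.cut u Z := by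
      rw [N.excess_eq_of_conservation hg hSZ htZ, cut, Nat.cast_sum]
      refine Finset.sum_lt_sum (fun e he => ?_) ⟨e₀, he₀, ?_⟩
      · have := hgu e he
        split_ifs <;> push_cast <;> omega
      · have := hgu e₀ he₀
        rcases hres with ⟨h1, h2, h3⟩ | ⟨h1, h2, h3⟩
        · simp [h1, h2, hiZ, hlZ, h3]
        · simp [h1, h2, hiZ, hlZ, h3]
    exact_mod_cast hval.trans_lt hlt

end Network

/-! ### Maximum flows and minimum cuts of directed graphs -/

namespace Digraph

variable {V : Type*} [Fintype V]

open Classical in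
/-- The number of edges of `G` that lead from `A` to its complement. -/
noncomputable def cutSize (G : Digraph V) (A : Set V) : ℕ :=
  (G.edges.filter fun e => e.1 ∈ A ∧ e.2 ∉ A).card

theorem mem_edges {G : Digraph V} {e : V × V} : e ∈ G.edges ↔ G.Adj e.1 e.2 := by
  simp [edges]

open Classical in
theorem sum_netOut (f : V → V → ℝ) (A : Set V) :
    ∑ v ∈ Finset.univ.filter (· ∈ A), netOut f v =
      ∑ e : V × V, ((if e.1 ∈ A ∧ e.2 ∉ A then f e.1 e.2 else 0) -
        if e.1 ∉ A ∧ e.2 ∈ A then f e.1 e.2 else 0) := by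
  have h1 : ∀ v, netOut f v = ∑ e : V × V,
      ((if e.1 = v then f e.1 e.2 else 0) - if e.2 = v then f e.1 e.2 else 0) := by
    intro v
    unfold netOut
    rw [Finset.sum_sub_distrib, Fintype.sum_prod_type, Fintype.sum_prod_type_right]
    simp
  simp_rw [h1]
  rw [Finset.sum_comm]
  refine Finset.sum_congr rfl fun e _ => ?_
  rw [Finset.sum_sub_distrib, Finset.sum_ite_eq, Finset.sum_ite_eq]
  by_cases h3 : e.1 ∈ A <;> by_cases h4 : e.2 ∈ A <;> simp [h3, h4]

open Classical in
theorem netOut_eq_of_isFlow {G : Digraph V} {s t : V} {f : V → V → ℝ} (hf : IsFlow G s t f)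
    {A : Set V} (hs : s ∈ A) (ht : t ∉ A) :
    netOut f s = ∑ e : V × V, ((if e.1 ∈ A ∧ e.2 ∉ A then f e.1 e.2 else 0) -
        if e.1 ∉ A ∧ e.2 ∈ A then f e.1 e.2 else 0) := by
  rw [← sum_netOut, Finset.sum_eq_single s]
  · intro v hv hvs
    refine hf.conservation v hvs fun h => ht ?_
    simpa [h] using hv
  · intro h
    simp [hs] at h

open Classical in
theorem cutSize_eq_sum (G : Digraph V) (A : Set V) :
    (G.cutSize A : ℝ) =
      ∑ e : V × V, if e.1 ∈ A ∧ e.2 ∉ A then (if G.Adj e.1 e.2 then (1 : ℝ) else 0) else 0 := by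
  unfold cutSize edges
  rw [Finset.filter_filter, ← Finset.sum_boole]
  refine Finset.sum_congr rfl fun e _ => ?_
  by_cases h1 : G.Adj e.1 e.2 <;> simp [h1]

theorem netOut_le_cutSize {G : Digraph V} {s t : V} {f : V → V → ℝ} (hf : IsFlow G s t f)
    {A : Set V} (hs : s ∈ A) (ht : t ∉ A) : netOut f s ≤ G.cutSize A := by
  classical
  rw [netOut_eq_of_isFlow hf hs ht, cutSize_eq_sum]
  refine Finset.sum_le_sum fun e _ => ?_
  have h0 := hf.nonneg e.1 e.2
  have h1 := hf.le_one e.1 e.2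
  have h2 := hf.support e.1 e.2
  by_cases h3 : e.1 ∈ A <;> by_cases h4 : e.2 ∈ A <;> by_cases h5 : G.Adj e.1 e.2 <;>
    simp [h3, h4, h5] at h2 ⊢ <;> linarith

theorem maxFlow_le_cutSize (G : Digraph V) {s t : V} {A : Set V} (hs : s ∈ A) (ht : t ∉ A) :
    maxFlow G s t ≤ G.cutSize A := by
  refine csSup_le (flowValues_nonempty G s t) ?_
  rintro x ⟨f, hf, rfl⟩
  exact netOut_le_cutSize hf hs ht

theorem maxFlow_mono {G H : Digraph V} (h : H ≤ G) (s t : V) : maxFlow H s t ≤ maxFlow G s t := by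
  refine csSup_le_csSup (flowValues_bddAbove G s t) (flowValues_nonempty H s t) ?_
  rintro x ⟨f, hf, rfl⟩
  exact ⟨f, ⟨hf.nonneg, hf.le_one, fun u v huv => hf.support u v fun h' => huv (h h'),
    hf.conservation⟩, rfl⟩

theorem maxFlow_self (G : Digraph V) (s : V) : maxFlow G s s = 0 := by
  classical
  have h : flowValues G s s = {0} := by
    refine Set.Subset.antisymm ?_ ?_
    · rintro x ⟨f, hf, rfl⟩
      have h1 := sum_netOut f Set.univ
      rw [Finset.sum_eq_single s (fun v _ hv => hf.conservation v hv hv) (by simp)] at h1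
      simpa using h1
    · rintro x rfl
      exact ⟨fun _ _ => 0, ⟨by simp, by simp, by simp, by simp [netOut]⟩, by simp [netOut]⟩
  rw [maxFlow, h, csSup_singleton]

theorem exists_isFlow_netOut_eq_maxFlow (G : Digraph V) (s t : V) :
    ∃ f, IsFlow G s t f ∧ netOut f s = maxFlow G s t := by
  have hcont : ∀ v, Continuous fun f : V → V → ℝ => netOut f v := by
    intro v
    unfold netOut
    fun_prop
  have hcomp : IsCompact {f : V → V → ℝ | IsFlow G s t f} := by
    have hbox : IsCompact (Set.Icc (fun _ _ => 0 : V → V → ℝ) fun _ _ => 1) := isCompact_Icc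
    refine hbox.of_isClosed_subset ?_ fun f hf => ⟨fun u v => hf.nonneg u v, fun u v => hf.le_one u v⟩
    have : {f : V → V → ℝ | IsFlow G s t f} =
        (⋂ u, ⋂ v, {f | 0 ≤ f u v}) ∩ (⋂ u, ⋂ v, {f | f u v ≤ 1}) ∩
        (⋂ u, ⋂ v, ⋂ _ : ¬ G.Adj u v, {f | f u v = 0}) ∩
        ⋂ v, ⋂ _ : v ≠ s, ⋂ _ : v ≠ t, {f | netOut f v = 0} := by
      ext f
      simp only [Set.mem_ofPred_eq, Set.mem_inter_iff, Set.mem_iInter]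
      exact ⟨fun h => ⟨⟨⟨h.1, h.2⟩, h.3⟩, h.4⟩, fun h => ⟨h.1.1.1, h.1.1.2, h.1.2, h.2⟩⟩
    rw [this]
    refine IsClosed.inter (IsClosed.inter (IsClosed.inter ?_ ?_) ?_) ?_
    · exact isClosed_iInter fun u => isClosed_iInter fun v =>
        isClosed_le continuous_const (by fun_prop)
    · exact isClosed_iInter fun u => isClosed_iInter fun v =>
        isClosed_le (by fun_prop) continuous_const
    · exact isClosed_iInter fun u => isClosed_iInter fun v => isClosed_iInter fun _ =>
        isClosed_eq (by fun_prop) continuous_const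
    · exact isClosed_iInter fun v => isClosed_iInter fun _ => isClosed_iInter fun _ =>
        isClosed_eq (hcont v) continuous_const
  have himg : flowValues G s t = (fun f => netOut f s) '' {f | IsFlow G s t f} := by
    ext x
    simp [flowValues]
  have hc : IsCompact (flowValues G s t) := himg ▸ hcomp.image (hcont s)
  exact hc.sSup_mem (flowValues_nonempty G s t)

open Classical in
/-- `f'` satisfies the capacity constraints of `G` and its net balance is that of `f` with `d`
additional units going from `s` to `v`. -/
structure IsShift (G : Digraph V) (f : V → V → ℝ) (s v : V) (d : ℝ) (f' : V → V → ℝ) : Prop where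
  nonneg : ∀ u w, 0 ≤ f' u w
  le_one : ∀ u w, f' u w ≤ 1
  support : ∀ u w, ¬ G.Adj u w → f' u w = 0
  netOut_eq : ∀ w, netOut f' w =
    netOut f w + (if w = s then d else 0) - if w = v then d else 0

open Classical in
theorem netOut_convex_add_single (f f' : V → V → ℝ) (θ η : ℝ) (a b w : V) :
    netOut (fun x y => (1 - θ) * f x y + θ * f' x y + if x = a ∧ y = b then η else 0) w =
      (1 - θ) * netOut f w + θ * netOut f' w + (if w = a then η else 0) -
        if w = b then η else 0 := by
  have h1 : ∑ x, (if w = a ∧ x = b then η else 0) = if w = a then η else 0 := by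
    by_cases h : w = a <;> simp [h]
  have h2 : ∑ x, (if x = a ∧ w = b then η else 0) = if w = b then η else 0 := by
    by_cases h : w = b <;> simp [h]
  unfold netOut
  simp only [Finset.sum_add_distrib, ← Finset.mul_sum, h1, h2]
  ring

/-- If some amount can be shifted from `s` to `v` and `(v, w)` is a residual arc, then some amount
can be shifted from `s` to `w`: a convex combination with `f` keeps the residual arc open. -/
theorem IsShift.exists_of_residual {G : Digraph V} {s t v w : V} {f f' : V → V → ℝ} {d : ℝ}
    (hf : IsFlow G s t f) (hd : 0 < d) (h : IsShift G f s v d f')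
    (hres : (G.Adj v w ∧ f v w < 1) ∨ 0 < f w v) :
    ∃ d' > 0, ∃ f'', IsShift G f s w d' f'' := by
  classical
  obtain ⟨ρ, hρ, hρ'⟩ : ∃ ρ : ℝ, 0 < ρ ∧ ((G.Adj v w ∧ f v w + ρ ≤ 1) ∨ ρ ≤ f w v) := by
    rcases hres with ⟨h1, h2⟩ | h1
    · exact ⟨1 - f v w, by linarith, Or.inl ⟨h1, by linarith⟩⟩
    · exact ⟨f w v, h1, Or.inr le_rfl⟩
  obtain ⟨θ, hθ, hθ1, hθd⟩ : ∃ θ : ℝ, 0 < θ ∧ θ ≤ 1 ∧ θ * (d + ρ) ≤ ρ := by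
    refine ⟨ρ / (d + ρ), by positivity, ?_, ?_⟩
    · rw [div_le_one (by positivity)]
      linarith
    · rw [div_mul_cancel₀ _ (by positivity)]
  have hθd' : 0 < θ * d := mul_pos hθ hd
  have c0 : ∀ x y, 0 ≤ (1 - θ) * f x y + θ * f' x y := fun x y =>
    add_nonneg (mul_nonneg (by linarith) (hf.nonneg x y)) (mul_nonneg hθ.le (h.nonneg x y))
  have c1 : ∀ x y, (1 - θ) * f x y + θ * f' x y ≤ 1 := fun x y => by
    nlinarith [hf.le_one x y, h.le_one x y]
  rcases hρ' with ⟨hadj, hle⟩ | hle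
  · refine ⟨θ * d, hθd', fun x y => (1 - θ) * f x y + θ * f' x y +
      if x = v ∧ y = w then θ * d else 0, ⟨fun x y => ?_, fun x y => ?_, fun x y hxy => ?_,
        fun x => ?_⟩⟩
    · have := c0 x y
      split_ifs <;> linarith
    · split_ifs with hxy
      · obtain ⟨rfl, rfl⟩ := hxy
        nlinarith [h.le_one x y]
      · linarith [c1 x y]
    · have : ¬ (x = v ∧ y = w) := fun hc => hxy (hc.1 ▸ hc.2 ▸ hadj)
      simp [this, hf.support x y hxy, h.support x y hxy]
    · rw [netOut_convex_add_single, h.netOut_eq]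
      split_ifs <;> ring
  · refine ⟨θ * d, hθd', fun x y => (1 - θ) * f x y + θ * f' x y +
      if x = w ∧ y = v then -(θ * d) else 0, ⟨fun x y => ?_, fun x y => ?_, fun x y hxy => ?_,
        fun x => ?_⟩⟩
    · split_ifs with hxy
      · obtain ⟨rfl, rfl⟩ := hxy
        nlinarith [h.nonneg x y]
      · linarith [c0 x y]
    · have := c1 x y
      split_ifs <;> linarith
    · have : ¬ (x = w ∧ y = v) := fun hc => by
        have := hf.support x y hxy
        rw [hc.1, hc.2] at this
        linarith
      simp [this, hf.support x y hxy, h.support x y hxy]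
    · rw [netOut_convex_add_single, h.netOut_eq]
      split_ifs <;> ring

/-- The max-flow min-cut theorem: the vertices to which a positive amount can be shifted, on top of
a maximum flow, form a cut whose size is the value of the flow. -/
theorem exists_cutSize_eq_maxFlow (G : Digraph V) {s t : V} (hst : s ≠ t) :
    ∃ A : Set V, s ∈ A ∧ t ∉ A ∧ (G.cutSize A : ℝ) = maxFlow G s t := by
  classical
  obtain ⟨f, hf, hmax⟩ := exists_isFlow_netOut_eq_maxFlow G s t
  let A : Set V := {v | ∃ d > 0, ∃ f', IsShift G f s v d f'}
  have hs : s ∈ A := ⟨1, one_pos, f, hf.nonneg, hf.le_one, hf.support, fun w => by ring⟩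
  have ht : t ∉ A := by
    rintro ⟨d, hd, f', h⟩
    have hf' : IsFlow G s t f' := ⟨h.nonneg, h.le_one, h.support, fun v hvs hvt => by
      rw [h.netOut_eq, hf.conservation v hvs hvt, if_neg hvs, if_neg hvt]
      ring⟩
    have h1 : netOut f' s ≤ maxFlow G s t :=
      le_csSup (flowValues_bddAbove G s t) ⟨f', hf', rfl⟩
    rw [h.netOut_eq, if_pos rfl, if_neg hst, hmax] at h1
    linarith
  refine ⟨A, hs, ht, ?_⟩
  rw [← hmax, netOut_eq_of_isFlow hf hs ht, cutSize_eq_sum]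
  refine Finset.sum_congr rfl fun e _ => ?_
  by_cases h1 : e.1 ∈ A <;> by_cases h2 : e.2 ∈ A <;> simp only [h1, h2, not_true,
    not_false_eq_true, and_true, and_false, if_true, if_false, sub_zero, sub_self]
  · obtain ⟨d, hd, f', h⟩ := h1
    split_ifs with hadj
    · refine le_antisymm (not_lt.1 fun hlt => h2 ?_) (hf.le_one _ _)
      exact h.exists_of_residual hf hd (Or.inl ⟨hadj, hlt⟩)
    · exact (hf.support _ _ hadj).symm
  · obtain ⟨d, hd, f', h⟩ := h2
    have : f e.1 e.2 = 0 := by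
      refine le_antisymm (not_lt.1 fun hlt => h1 ?_) (hf.nonneg _ _)
      exact h.exists_of_residual hf hd (Or.inr hlt)
    simp [this]

/-- A criterion for preservers in terms of cuts only. -/
theorem isFTBFP_of_cutSize {lam k : ℕ} {G H : Digraph V} {s : V} (hle : H ≤ G)
    (h : ∀ F ⊆ G.edges, F.card ≤ k → ∀ A : Set V, s ∈ A →
      lam ≤ (H.deleteEdges F).cutSize A ∨
      ∃ B ⊆ A, s ∈ B ∧ (G.deleteEdges F).cutSize B ≤ (H.deleteEdges F).cutSize A) :
    IsFTBFP lam k G s H := by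
  refine ⟨hle, fun F hF hk t => ?_⟩
  have hle' : H.deleteEdges F ≤ G.deleteEdges F := fun u v huv => ⟨hle huv.1, huv.2⟩
  have hmono := maxFlow_mono hle' s t
  by_cases hst : s = t
  · subst hst
    simp only [maxFlow_self, implies_true, true_and]
    exact fun h => h.le
  obtain ⟨A, hs, ht, hA⟩ := exists_cutSize_eq_maxFlow (H.deleteEdges F) hst
  have key : (lam : ℝ) ≤ maxFlow (H.deleteEdges F) s t ∨
      maxFlow (G.deleteEdges F) s t ≤ maxFlow (H.deleteEdges F) s t := by
    rcases h F hF hk A hs with h1 | ⟨B, hBA, hsB, hB⟩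
    · left
      rw [← hA]
      exact_mod_cast h1
    · right
      rw [← hA]
      exact (maxFlow_le_cutSize _ hsB fun h' => ht (hBA h')).trans (by exact_mod_cast hB)
  constructor
  · intro h1
    rcases key with h2 | h2 <;> linarith
  · intro h1
    rcases key with h2 | h2 <;> linarith

theorem card_edges_le {H : Digraph V} {b : ℕ} (h : ∀ v, H.inDegree v ≤ b) :
    H.edges.card ≤ b * Fintype.card V := by
  classical
  have h1 : H.edges.card = ∑ v, H.inDegree v := by
    rw [Finset.card_eq_sum_card_fiberwise (f := Prod.snd) (t := Finset.univ) (by simp)]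
    refine Finset.sum_congr rfl fun v _ => ?_
    unfold inDegree edges
    refine Finset.card_bij (fun e _ => e.1) ?_ ?_ ?_
    · rintro ⟨a, b⟩ h
      simp only [Finset.mem_filter, Finset.mem_univ, true_and] at h ⊢
      exact h.2 ▸ h.1
    · rintro ⟨a, b⟩ h ⟨a', b'⟩ h' hab
      simp only [Finset.mem_filter, Finset.mem_univ, true_and] at h h'
      simp only [Prod.mk.injEq]
      exact ⟨hab, h.2.trans h'.2.symm⟩
    · intro a ha
      simp only [Finset.mem_filter, Finset.mem_univ, true_and] at ha
      exact ⟨(a, v), by simpa using ha, rfl⟩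
  rw [h1, mul_comm]
  exact (Finset.sum_le_card_nsmul _ _ b fun v _ => h v).trans (by simp)

end Digraph

/-! ### A program logic for the word RAM -/

namespace WordRAM

@[simp] theorem State.setReg_reg_self (σ : State) (x y : ℕ) : (σ.setReg x y).reg x = y := by
  simp [State.setReg]

@[simp] theorem State.setReg_reg_of_ne (σ : State) {x z : ℕ} (y : ℕ) (h : z ≠ x) :
    (σ.setReg x y).reg z = σ.reg z := by
  simp [State.setReg, h]

@[simp] theorem State.setReg_mem (σ : State) (x y : ℕ) : (σ.setReg x y).mem = σ.mem := rfl

@[simp] theorem State.setMem_reg (σ : State) (a i y : ℕ) : (σ.setMem a i y).reg = σ.reg := rfl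

@[simp] theorem State.setMem_mem_self (σ : State) (a i y : ℕ) :
    (σ.setMem a i y).mem a = Function.update (σ.mem a) i y := by
  simp [State.setMem]

@[simp] theorem State.setMem_mem_of_ne (σ : State) {a b : ℕ} (i y : ℕ) (h : b ≠ a) :
    (σ.setMem a i y).mem b = σ.mem b := by
  simp [State.setMem, h]

/-- All words stored in `σ` are smaller than `W`. The bound `1 < W` makes truth values fit. -/
structure State.Bounded (W : ℕ) (σ : State) : Prop where
  one_lt : 1 < W
  reg_lt : ∀ x, σ.reg x < W
  mem_lt : ∀ a i, σ.mem a i < W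

/-- The only overflow that an operation can cause on words smaller than the bound. -/
def Op.Safe (W : ℕ) : Op → ℕ → ℕ → Prop
  | .add, x, y => x + y < W
  | .mul, x, y => x * y < W
  | _, _, _ => True

/-- In a bounded state, the condition under which the evaluation of an expression fits. -/
def Expr.Safe (W : ℕ) (σ : State) : Expr → Prop
  | .const c => c < W
  | .reg _ => True
  | .get _ i => i.Safe W σ
  | .op o e₁ e₂ => e₁.Safe W σ ∧ e₂.Safe W σ ∧ o.Safe W (e₁.eval σ) (e₂.eval σ)

theorem Expr.Fits.eval_lt {W : ℕ} {σ : State} {e : Expr} (h : e.Fits W σ) : e.eval σ < W := by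
  cases e with
  | const c => exact h
  | reg x => exact h
  | get a i => exact h.2
  | op o e₁ e₂ => exact h.2.2

theorem Expr.Safe.fits {W : ℕ} {σ : State} (hσ : σ.Bounded W) :
    ∀ {e : Expr}, e.Safe W σ → e.Fits W σ
  | .const _, h => h
  | .reg x, _ => hσ.reg_lt x
  | .get a i, h => ⟨Expr.Safe.fits hσ (e := i) h, hσ.mem_lt a _⟩
  | .op o e₁ e₂, h => by
    have h1 := Expr.Safe.fits hσ h.1
    have h2 := Expr.Safe.fits hσ h.2.1
    have h3 := h1.eval_lt
    have h4 := hσ.one_lt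
    refine ⟨h1, h2, ?_⟩
    cases o with
    | add => exact h.2.2
    | mul => exact h.2.2
    | sub => exact (Nat.sub_le _ _).trans_lt h3
    | div => exact (Nat.div_le_self _ _).trans_lt h3
    | lt => simp only [Op.app]; split_ifs <;> omega
    | eq => simp only [Op.app]; split_ifs <;> omega

theorem State.Bounded.setReg {W : ℕ} {σ : State} (h : σ.Bounded W) (x : ℕ) {y : ℕ} (hy : y < W) :
    (σ.setReg x y).Bounded W := by
  refine ⟨h.one_lt, fun z => ?_, h.mem_lt⟩
  by_cases hz : z = x
  · subst hz; simpa using hy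
  · simpa [hz] using h.reg_lt z

theorem State.Bounded.setMem {W : ℕ} {σ : State} (h : σ.Bounded W) (a i : ℕ) {y : ℕ} (hy : y < W) :
    (σ.setMem a i y).Bounded W := by
  refine ⟨h.one_lt, h.reg_lt, fun b l => ?_⟩
  by_cases hb : b = a
  · subst hb
    by_cases hl : l = i
    · subst hl; simpa using hy
    · simpa [hl] using h.mem_lt b l
  · simpa [hb] using h.mem_lt b l

theorem Exec.bounded {W : ℕ} {P : Program} {σ τ : State} {T : ℕ} (h : Exec W P σ τ T)
    (hσ : σ.Bounded W) : τ.Bounded W := by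
  induction h with
  | skip => exact hσ
  | assign σ x e he => exact hσ.setReg x he.eval_lt
  | store σ a i e hi he => exact hσ.setMem a _ he.eval_lt
  | seq _ _ ih₁ ih₂ => exact ih₂ (ih₁ hσ)
  | ite_true _ _ _ ih => exact ih hσ
  | ite_false _ _ _ ih => exact ih hσ
  | loop_false => exact hσ
  | loop_true _ _ _ _ ih₁ ih₂ => exact ih₂ (ih₁ hσ)

/-- The program never assigns to the register `x`. -/
def Program.keepsReg (x : ℕ) : Program → Bool
  | .skip => true
  | .assign y _ => x != y
  | .store _ _ _ => true
  | .seq P Q => P.keepsReg x && Q.keepsReg x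
  | .ite _ P Q => P.keepsReg x && Q.keepsReg x
  | .loop _ P => P.keepsReg x

/-- The program never stores into the array `a`. -/
def Program.keepsMem (a : ℕ) : Program → Bool
  | .skip => true
  | .assign _ _ => true
  | .store b _ _ => a != b
  | .seq P Q => P.keepsMem a && Q.keepsMem a
  | .ite _ P Q => P.keepsMem a && Q.keepsMem a
  | .loop _ P => P.keepsMem a

theorem Exec.reg_eq {W : ℕ} {P : Program} {σ τ : State} {T : ℕ} (h : Exec W P σ τ T) {x : ℕ}
    (hx : P.keepsReg x = true) : τ.reg x = σ.reg x := by
  induction h with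
  | skip => rfl
  | assign σ y e he => exact State.setReg_reg_of_ne _ _ (by simpa [Program.keepsReg] using hx)
  | store => rfl
  | seq _ _ ih₁ ih₂ =>
    simp only [Program.keepsReg, Bool.and_eq_true] at hx
    rw [ih₂ hx.2, ih₁ hx.1]
  | ite_true _ _ _ ih =>
    simp only [Program.keepsReg, Bool.and_eq_true] at hx
    exact ih hx.1
  | ite_false _ _ _ ih =>
    simp only [Program.keepsReg, Bool.and_eq_true] at hx
    exact ih hx.2
  | loop_false => rfl
  | loop_true _ _ _ _ ih₁ ih₂ => rw [ih₂ hx, ih₁ hx]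

theorem Exec.mem_eq {W : ℕ} {P : Program} {σ τ : State} {T : ℕ} (h : Exec W P σ τ T) {a : ℕ}
    (ha : P.keepsMem a = true) : τ.mem a = σ.mem a := by
  induction h with
  | skip => rfl
  | assign => rfl
  | store σ b i e => exact State.setMem_mem_of_ne _ _ _ (by simpa [Program.keepsMem] using ha)
  | seq _ _ ih₁ ih₂ =>
    simp only [Program.keepsMem, Bool.and_eq_true] at ha
    rw [ih₂ ha.2, ih₁ ha.1]
  | ite_true _ _ _ ih =>
    simp only [Program.keepsMem, Bool.and_eq_true] at ha
    exact ih ha.1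
  | ite_false _ _ _ ih =>
    simp only [Program.keepsMem, Bool.and_eq_true] at ha
    exact ih ha.2
  | loop_false => rfl
  | loop_true _ _ _ _ ih₁ ih₂ => rw [ih₂ ha, ih₁ ha]

/-- Total correctness with a time bound: from the state `σ`, the program `P` halts within `B` steps
in a state that satisfies `Q`. -/
def Run (W : ℕ) (P : Program) (σ : State) (B : ℕ) (Q : State → Prop) : Prop :=
  ∃ τ T, Exec W P σ τ T ∧ T ≤ B ∧ Q τ

/-- The registers and arrays that `P` does not write to agree in `σ` and `τ`. -/
structure Frame (P : Program) (σ τ : State) : Prop where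
  reg : ∀ x, P.keepsReg x = true → τ.reg x = σ.reg x
  mem : ∀ a, P.keepsMem a = true → τ.mem a = σ.mem a

namespace Run

variable {W : ℕ} {P P' : Program} {σ : State} {B B' : ℕ} {Q R : State → Prop}

theorem mono (h : Run W P σ B Q) (hB : B ≤ B') (hQ : ∀ τ, Q τ → R τ) : Run W P σ B' R := by
  obtain ⟨τ, T, h1, h2, h3⟩ := h
  exact ⟨τ, T, h1, h2.trans hB, hQ τ h3⟩

theorem frame (hσ : σ.Bounded W) (h : Run W P σ B Q) :
    Run W P σ B fun τ => τ.Bounded W ∧ Frame P σ τ ∧ Q τ := by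
  obtain ⟨τ, T, h1, h2, h3⟩ := h
  exact ⟨τ, T, h1, h2, h1.bounded hσ, ⟨fun _ => h1.reg_eq, fun _ => h1.mem_eq⟩, h3⟩

theorem seq (hσ : σ.Bounded W) (h₁ : Run W P σ B Q)
    (h₂ : ∀ τ, τ.Bounded W → Frame P σ τ → Q τ → Run W P' τ B' R) :
    Run W (.seq P P') σ (B + B') R := by
  obtain ⟨τ, T, h1, h2, h3, h4, h5⟩ := h₁.frame hσ
  obtain ⟨ρ, U, h6, h7, h8⟩ := h₂ τ h3 h4 h5
  exact ⟨ρ, T + U, .seq h1 h6, by omega, h8⟩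

theorem ite {b : Expr} (hσ : σ.Bounded W) (hb : b.Safe W σ)
    (h₁ : b.eval σ ≠ 0 → Run W P σ B Q) (h₂ : b.eval σ = 0 → Run W P' σ B' Q) :
    Run W (.ite b P P') σ (b.cost + 1 + (B + B')) Q := by
  by_cases h : b.eval σ = 0
  · obtain ⟨τ, T, h3, h4, h5⟩ := h₂ h
    exact ⟨τ, _, .ite_false (hb.fits hσ) h h3, by omega, h5⟩
  · obtain ⟨τ, T, h3, h4, h5⟩ := h₁ h
    exact ⟨τ, _, .ite_true (hb.fits hσ) h h3, by omega, h5⟩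

theorem loop_of_forall {b : Expr} {B : ℕ} (I : ℕ → State → Prop)
    (hI : ∀ μ σ, σ.Bounded W → I μ σ → b.Safe W σ ∧
      (b.eval σ ≠ 0 → Run W P σ B fun τ => ∃ μ' < μ, I μ' τ)) :
    ∀ (μ : ℕ) (σ : State), σ.Bounded W → I μ σ →
      Run W (.loop b P) σ ((b.cost + 1 + B) * μ + (b.cost + 1))
        fun τ => (∃ μ', I μ' τ) ∧ b.eval τ = 0 := by
  intro μ
  induction μ using Nat.strong_induction_on with
  | _ μ ih =>
    intro σ hσ hμ
    obtain ⟨hb, hstep⟩ := hI μ σ hσ hμ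
    by_cases h : b.eval σ = 0
    · exact ⟨σ, _, .loop_false (hb.fits hσ) h, Nat.le_add_left _ _, ⟨μ, hμ⟩, h⟩
    · obtain ⟨τ, T, h1, h2, μ', hμ', h3⟩ := hstep h
      obtain ⟨ρ, U, h4, h5, h6⟩ := ih μ' hμ' τ (h1.bounded hσ) h3
      refine ⟨ρ, _, .loop_true (hb.fits hσ) h h1 h4, ?_, h6⟩
      have h7 : (b.cost + 1 + B) * (μ' + 1) ≤ (b.cost + 1 + B) * μ := Nat.mul_le_mul_left _ hμ'
      rw [Nat.mul_add, Nat.mul_one] at h7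
      omega

/-- The rule for loops. The invariant carries a measure that every iteration decreases. -/
theorem loop {b : Expr} {B : ℕ} (hσ : σ.Bounded W) (I : ℕ → State → Prop) (μ : ℕ) (hμ : I μ σ)
    (hI : ∀ μ τ, τ.Bounded W → Frame P σ τ → I μ τ → b.Safe W τ ∧
      (b.eval τ ≠ 0 → Run W P τ B fun ρ => ∃ μ' < μ, I μ' ρ)) :
    Run W (.loop b P) σ ((b.cost + 1 + B) * μ + (b.cost + 1))
      fun τ => (∃ μ', I μ' τ) ∧ b.eval τ = 0 := by
  refine (loop_of_forall (fun μ τ => Frame P σ τ ∧ I μ τ) (fun μ τ hτ h => ?_) μ σ hσ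
    ⟨⟨fun _ _ => rfl, fun _ _ => rfl⟩, hμ⟩).mono le_rfl ?_
  · obtain ⟨h1, h2⟩ := hI μ τ hτ h.1 h.2
    refine ⟨h1, fun hb => ((h2 hb).frame hτ).mono le_rfl ?_⟩
    rintro ρ ⟨_, hfr, μ', hμ', hI'⟩
    exact ⟨μ', hμ', ⟨fun x hx => (hfr.reg x hx).trans (h.1.reg x hx),
      fun a ha => (hfr.mem a ha).trans (h.1.mem a ha)⟩, hI'⟩
  · rintro τ ⟨⟨μ', _, h1⟩, h2⟩
    exact ⟨⟨μ', h1⟩, h2⟩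

end Run

/-- An upper bound for the number of steps of a loop-free program. -/
def Program.cost : Program → ℕ
  | .skip => 1
  | .assign _ e => e.cost + 1
  | .store _ i e => i.cost + e.cost + 1
  | .seq P Q => P.cost + Q.cost
  | .ite b P Q => b.cost + 1 + (P.cost + Q.cost)
  | .loop _ _ => 0

/-- The weakest precondition of a loop-free program, for total correctness without overflow; a
loop has none. -/
def Program.wp (W : ℕ) : Program → (State → Prop) → State → Prop
  | .skip, Q, σ => Q σ
  | .assign x e, Q, σ => e.Safe W σ ∧ Q (σ.setReg x (e.eval σ))
  | .store a i e, Q, σ => i.Safe W σ ∧ e.Safe W σ ∧ Q (σ.setMem a (i.eval σ) (e.eval σ))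
  | .seq P P', Q, σ => P.wp W (P'.wp W Q) σ
  | .ite b P P', Q, σ =>
    b.Safe W σ ∧ (b.eval σ ≠ 0 → P.wp W Q σ) ∧ (b.eval σ = 0 → P'.wp W Q σ)
  | .loop _ _, _, _ => False

theorem Run.of_wp {W : ℕ} : ∀ {P : Program} {σ : State} {Q : State → Prop}, σ.Bounded W →
    P.wp W Q σ → Run W P σ P.cost Q
  | .skip, σ, _, _, h => ⟨σ, _, .skip σ, le_rfl, h⟩
  | .assign x e, σ, _, hσ, h => ⟨_, _, .assign σ x e (h.1.fits hσ), le_rfl, h.2⟩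
  | .store a i e, σ, _, hσ, h =>
    ⟨_, _, .store σ a i e (h.1.fits hσ) (h.2.1.fits hσ), le_rfl, h.2.2⟩
  | .seq P P', _, Q, hσ, h =>
    (Run.of_wp (P := P) (Q := P'.wp W Q) hσ h).seq hσ fun _ hτ _ h' => Run.of_wp hτ h'
  | .ite _ _ _, _, _, hσ, h =>
    Run.ite hσ h.1 (fun hb => Run.of_wp hσ (h.2.1 hb)) fun hb => Run.of_wp hσ (h.2.2 hb)
  | .loop _ _, _, _, _, h => h.elim

/-- The loop in which register `i` runs through the numbers below the value of register `n`. -/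
def Program.forTo (i n : ℕ) (P : Program) : Program :=
  .seq (.assign i (.const 0)) (.loop (.op .lt (.reg i) (.reg n))
    (.seq P (.assign i (.op .add (.reg i) (.const 1)))))

theorem Run.forTo {W : ℕ} {P : Program} {i n : ℕ} (hin : n ≠ i) (hi : P.keepsReg i = true)
    (hn : P.keepsReg n = true) {σ : State} (hσ : σ.Bounded W) {B : ℕ} (I : ℕ → State → Prop)
    (h₀ : I 0 (σ.setReg i 0))
    (h : ∀ j < σ.reg n, ∀ τ : State, τ.Bounded W →
      (∀ x, x ≠ i → P.keepsReg x = true → τ.reg x = σ.reg x) →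
      (∀ a, P.keepsMem a = true → τ.mem a = σ.mem a) → τ.reg i = j → I j τ →
      Run W P τ B fun ρ => I (j + 1) (ρ.setReg i (j + 1))) :
    Run W (Program.forTo i n P) σ ((B + 8) * σ.reg n + 6) (I (σ.reg n)) := by
  have hzero : Run W (.assign i (.const 0)) σ 2 fun τ => τ = σ.setReg i 0 :=
    Run.of_wp hσ ⟨show 0 < W from lt_trans Nat.zero_lt_one hσ.one_lt, rfl⟩
  refine (hzero.seq hσ (B' := (B + 8) * σ.reg n + 4) fun τ hτ _ h1 => ?_).mono (by omega)
    fun _ h => h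
  let J : ℕ → State → Prop := fun μ τ => τ.reg i ≤ σ.reg n ∧ μ = σ.reg n - τ.reg i ∧
    (∀ x, x ≠ i → P.keepsReg x = true → τ.reg x = σ.reg x) ∧
    (∀ a, P.keepsMem a = true → τ.mem a = σ.mem a) ∧ I (τ.reg i) τ
  have hJ : J (σ.reg n) τ := by
    subst h1
    exact ⟨by simp, by simp, fun x hx _ => by simp [hx], fun _ _ => rfl, by simpa using h₀⟩
  refine (Run.loop (B := B + 4) hτ J _ hJ fun μ τ hτ _ hJτ => ?_).mono ?_ ?_
  · obtain ⟨h2, h3, h4, h5, h6⟩ := hJτ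
    refine ⟨⟨trivial, trivial, trivial⟩, fun hb => ?_⟩
    have hlt : τ.reg i < σ.reg n := by
      have h7 := h4 n hin hn
      simp only [Expr.eval, Op.app, h7] at hb
      by_contra hc
      simp [hc] at hb
    have hb := h (τ.reg i) hlt τ hτ h4 h5 rfl h6
    refine hb.seq hτ fun ρ hρ hfr hI => ?_
    have h8 : ρ.reg i = τ.reg i := hfr.reg i hi
    have h9 := hσ.reg_lt n
    refine Run.of_wp (P := .assign i (.op .add (.reg i) (.const 1))) hρ ⟨⟨trivial, ?_, ?_⟩, ?_⟩
    · exact hρ.one_lt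
    · change ρ.reg i + 1 < W
      omega
    · refine ⟨σ.reg n - (τ.reg i + 1), by omega, ?_⟩
      have h10 : Expr.eval ρ (.op .add (.reg i) (.const 1)) = τ.reg i + 1 := by
        simp [Expr.eval, Op.app, h8]
      rw [h10]
      refine ⟨by simpa using hlt, by simp, fun x hx hxP => ?_, fun a ha => ?_, by simpa using hI⟩
      · rw [State.setReg_reg_of_ne _ _ hx, hfr.reg x hxP, h4 x hx hxP]
      · rw [State.setReg_mem, hfr.mem a ha, h5 a ha]
  · simp only [Expr.cost]
    rw [show 1 + 1 + 1 + 1 + (B + 4) = B + 8 by omega]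
  · rintro ρ ⟨⟨μ, h2, _, h4, _, h6⟩, hb⟩
    have h7 := h4 n hin hn
    simp only [Expr.eval, Op.app, h7] at hb
    have : ρ.reg i = σ.reg n := by
      split_ifs at hb with hc
      omega
    rwa [this] at h6

end WordRAM

/-! ### Residual networks stored in arrays -/

namespace Residual

/-- One plus the largest `a < i` with `dst a = v`, and zero if there is none. The incoming arcs of a
vertex are linked in decreasing order, so these numbers are the pointers of the linked lists. -/
def lastArc (dst : ℕ → ℕ) : ℕ → ℕ → ℕ
  | 0, _ => 0
  | i + 1, v => if dst i = v then i + 1 else lastArc dst i v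

theorem lastArc_le (dst : ℕ → ℕ) (i v : ℕ) : lastArc dst i v ≤ i := by
  induction i with
  | zero => exact le_rfl
  | succ i ih => rw [lastArc]; split_ifs <;> omega

theorem dst_lastArc_sub_one {dst : ℕ → ℕ} {i v : ℕ} (h : lastArc dst i v ≠ 0) :
    dst (lastArc dst i v - 1) = v := by
  induction i with
  | zero => exact absurd rfl h
  | succ i ih =>
    rw [lastArc] at h ⊢
    split_ifs at h ⊢ with h1
    · simpa using h1
    · exact ih h

theorem dst_ne_of_lastArc_le {dst : ℕ → ℕ} {i v a : ℕ} (h : lastArc dst i v ≤ a) (ha : a < i) :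
    dst a ≠ v := by
  induction i with
  | zero => omega
  | succ i ih =>
    rw [lastArc] at h
    split_ifs at h with h1
    · omega
    · rcases Nat.lt_succ_iff_lt_or_eq.1 ha with h2 | rfl
      · exact ih h h2
      · exact h1

/-- An arc has been scanned if it enters a vertex of the queue that has been taken out, and, in the
case of the last such vertex, if the pointer `p` has passed it. -/
def Scanned (dst q : ℕ → ℕ) (qh p a : ℕ) : Prop := ∃ i < qh, dst a = q i ∧ (i + 1 < qh ∨ p ≤ a)

/-- The state of a backward search from `t` in the residual network on the arcs `a < L` from
`src a` to `dst a` with residual capacities `res a`. The queue `q` holds the vertices found, those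
before position `qh` having been taken out; `p` is the pointer into the list of the incoming arcs
of the vertex taken out last; `par v` is the arc by which `v` was found. The search stops, with
`found ≠ 0`, at a vertex `x` of the source set `S`. -/
structure Search (L : ℕ) (src dst res : ℕ → ℕ) (t : ℕ) (S : Set ℕ) (vis q par : ℕ → ℕ)
    (qh qt p found x : ℕ) : Prop where
  zero : q 0 = t
  pos : 0 < qt
  le : qh ≤ qt
  inj : ∀ i < qt, ∀ l < qt, q i = q l → i = l
  vis_iff : ∀ a < L, vis (src a) ≠ 0 ↔ ∃ i < qt, q i = src a
  par_spec : ∀ i < qt, 0 < i → par (q i) < L ∧ src (par (q i)) = q i ∧ 0 < res (par (q i)) ∧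
    ∃ l < i, dst (par (q i)) = q l
  pointer_le : p ≤ L
  pointer : p ≠ 0 → 0 < qh ∧ dst (p - 1) = q (qh - 1)
  closed : ∀ a < L, 0 < res a → Scanned dst q qh p a → ∃ l < qt, q l = src a
  miss : found = 0 → ∀ i < qt, q i ∉ S
  hit : found ≠ 0 → ∃ i < qt, q i = x ∧ x ∈ S

open Classical in
/-- A bound for the number of steps that remain: every arc is scanned at most once, adding at most
one vertex to the queue, and every vertex is taken out at most once. -/
noncomputable def searchMeasure (L : ℕ) (dst q : ℕ → ℕ) (qh qt p : ℕ) : ℕ :=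
  2 * ((Finset.range L).filter fun a => ¬ Scanned dst q qh p a).card + (qt - qh)

theorem searchMeasure_lt_of_dequeue {L : ℕ} {dst q : ℕ → ℕ} {qh qt p p' : ℕ}
    (h : ∀ a < L, Scanned dst q qh p a → Scanned dst q (qh + 1) p' a) (hlt : qh < qt) :
    searchMeasure L dst q (qh + 1) qt p' < searchMeasure L dst q qh qt p := by
  classical
  unfold searchMeasure
  have : ((Finset.range L).filter fun a => ¬ Scanned dst q (qh + 1) p' a).card ≤
      ((Finset.range L).filter fun a => ¬ Scanned dst q qh p a).card := by
    refine Finset.card_le_card fun a ha => ?_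
    simp only [Finset.mem_filter, Finset.mem_range] at ha ⊢
    exact ⟨ha.1, fun hs => ha.2 (h a ha.1 hs)⟩
  omega

theorem searchMeasure_lt_of_scan {L : ℕ} {dst q q' : ℕ → ℕ} {qh qt qt' p p' b : ℕ}
    (h : ∀ a < L, Scanned dst q qh p a → Scanned dst q' qh p' a) (hb : b < L)
    (hb₁ : ¬ Scanned dst q qh p b) (hb₂ : Scanned dst q' qh p' b) (hqt : qt' ≤ qt + 1) :
    searchMeasure L dst q' qh qt' p' < searchMeasure L dst q qh qt p := by
  classical
  unfold searchMeasure
  have : ((Finset.range L).filter fun a => ¬ Scanned dst q' qh p' a).card <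
      ((Finset.range L).filter fun a => ¬ Scanned dst q qh p a).card := by
    refine Finset.card_lt_card ⟨fun a ha => ?_, fun hsub => ?_⟩
    · simp only [Finset.mem_filter, Finset.mem_range] at ha ⊢
      exact ⟨ha.1, fun hs => ha.2 (h a ha.1 hs)⟩
    · have := hsub (show b ∈ _ by simp [hb, hb₁])
      simp [hb₂] at this
  omega

theorem searchMeasure_le (L : ℕ) (dst q : ℕ → ℕ) (qh qt p : ℕ) :
    searchMeasure L dst q qh qt p ≤ 2 * L + qt := by
  classical
  unfold searchMeasure
  have := Finset.card_filter_le (Finset.range L) fun a => ¬ Scanned dst q qh p a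
  rw [Finset.card_range] at this
  omega

theorem Search.start {L : ℕ} {src dst res : ℕ → ℕ} {t : ℕ} {S : Set ℕ} {vis q : ℕ → ℕ}
    (par : ℕ → ℕ) (x : ℕ) (htS : t ∉ S) (hq : q 0 = t)
    (hvis : ∀ a < L, vis (src a) ≠ 0 ↔ src a = t) :
    Search L src dst res t S vis q par 0 1 0 0 x where
  zero := hq
  pos := Nat.one_pos
  le := Nat.zero_le _
  inj i hi l hl _ := by omega
  vis_iff a ha := by
    rw [hvis a ha]
    exact ⟨fun h => ⟨0, Nat.one_pos, hq.trans h.symm⟩, fun ⟨i, hi, h⟩ => by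
      obtain rfl : i = 0 := by omega
      exact h.symm.trans hq⟩
  par_spec i hi h := by omega
  pointer_le := Nat.zero_le _
  pointer h := absurd rfl h
  closed a _ _ h := by
    obtain ⟨i, hi, _⟩ := h
    omega
  miss _ i hi := by
    obtain rfl : i = 0 := by omega
    rwa [hq]
  hit h := absurd rfl h

namespace Search

variable {L : ℕ} {src dst res : ℕ → ℕ} {t : ℕ} {S : Set ℕ} {vis q par : ℕ → ℕ}
  {qh qt p found x : ℕ}

theorem le_succ (h : Search L src dst res t S vis q par qh qt p found x) : qt ≤ L + 1 := by
  have h1 : (Finset.Ico 1 qt).card ≤ (Finset.range L).card := by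
    refine Finset.card_le_card_of_injOn (fun i => par (q i)) (fun i hi => ?_)
      fun i hi l hl hil => ?_
    · rw [Finset.coe_Ico, Set.mem_Ico] at hi
      simpa using (h.par_spec i hi.2 hi.1).1
    · rw [Finset.coe_Ico, Set.mem_Ico] at hi hl
      refine h.inj i hi.2 l hl.2 ?_
      rw [← (h.par_spec i hi.2 hi.1).2.1, ← (h.par_spec l hl.2 hl.1).2.1]
      exact congrArg src hil
  simp only [Nat.card_Ico, Finset.card_range] at h1
  omega

theorem dequeue (h : Search L src dst res t S vis q par qh qt 0 found x) (hlt : qh < qt) :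
    Search L src dst res t S vis q par (qh + 1) qt (lastArc dst L (q qh)) found x ∧
      searchMeasure L dst q (qh + 1) qt (lastArc dst L (q qh)) < searchMeasure L dst q qh qt 0 := by
  have hs : ∀ a, Scanned dst q qh 0 a → Scanned dst q (qh + 1) (lastArc dst L (q qh)) a := by
    rintro a ⟨i, hi, h1, _⟩
    exact ⟨i, by omega, h1, by omega⟩
  refine ⟨{ h with
    le := hlt
    pointer_le := lastArc_le _ _ _
    pointer := fun h0 => ⟨Nat.succ_pos _, by simpa using dst_lastArc_sub_one h0⟩
    closed := fun a ha h1 h2 => h.closed a ha h1 ?_ },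
    searchMeasure_lt_of_dequeue (fun a _ => hs a) hlt⟩
  obtain ⟨i, hi, h3, h4⟩ := h2
  rcases h4 with h4 | h4
  · exact ⟨i, by omega, h3, Or.inr (Nat.zero_le _)⟩
  · rcases Nat.lt_succ_iff_lt_or_eq.1 hi with h5 | rfl
    · exact ⟨i, h5, h3, Or.inr (Nat.zero_le _)⟩
    · exact absurd h3 (dst_ne_of_lastArc_le h4 ha)

/-- Moving the pointer over the arc `p - 1` scans this arc and no other. -/
theorem scanned_advance (h : Search L src dst res t S vis q par qh qt p found x) (hp : p ≠ 0) :
    ¬ Scanned dst q qh p (p - 1) ∧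
      Scanned dst q qh (lastArc dst (p - 1) (dst (p - 1))) (p - 1) ∧
      (∀ a, Scanned dst q qh p a → Scanned dst q qh (lastArc dst (p - 1) (dst (p - 1))) a) ∧
      ∀ a, Scanned dst q qh (lastArc dst (p - 1) (dst (p - 1))) a →
        a = p - 1 ∨ Scanned dst q qh p a := by
  obtain ⟨h1, h2⟩ := h.pointer hp
  have h3 := lastArc_le dst (p - 1) (dst (p - 1))
  have hle := h.le
  refine ⟨?_, ⟨qh - 1, by omega, h2, Or.inr h3⟩, ?_, ?_⟩
  · rintro ⟨i, hi, h4, h5⟩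
    have := h.inj i (by omega) (qh - 1) (by omega) (h4.symm.trans h2)
    omega
  · rintro a ⟨i, hi, h4, h5⟩
    exact ⟨i, hi, h4, by omega⟩
  · rintro a ⟨i, hi, h4, h5⟩
    rcases h5 with h5 | h5
    · exact Or.inr ⟨i, hi, h4, Or.inl h5⟩
    · by_cases h6 : i + 1 < qh
      · exact Or.inr ⟨i, hi, h4, Or.inl h6⟩
      obtain rfl : i = qh - 1 := by omega
      rcases lt_trichotomy a (p - 1) with h7 | h7 | h7
      · exact absurd (h4.trans h2.symm) (dst_ne_of_lastArc_le h5 h7)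
      · exact Or.inl h7
      · exact Or.inr ⟨qh - 1, hi, h4, Or.inr (by omega)⟩

theorem pointer_advance (h : Search L src dst res t S vis q par qh qt p found x) (hp : p ≠ 0) :
    lastArc dst (p - 1) (dst (p - 1)) ≤ L ∧ (lastArc dst (p - 1) (dst (p - 1)) ≠ 0 →
      0 < qh ∧ dst (lastArc dst (p - 1) (dst (p - 1)) - 1) = q (qh - 1)) := by
  obtain ⟨h1, h2⟩ := h.pointer hp
  have h3 := lastArc_le dst (p - 1) (dst (p - 1))
  have h4 := h.pointer_le
  exact ⟨by omega, fun h0 => ⟨h1, by rw [dst_lastArc_sub_one h0, h2]⟩⟩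

theorem skip (h : Search L src dst res t S vis q par qh qt p found x) (hp : p ≠ 0)
    (hres : res (p - 1) ≠ 0 → vis (src (p - 1)) ≠ 0) :
    Search L src dst res t S vis q par qh qt (lastArc dst (p - 1) (dst (p - 1))) found x ∧
      searchMeasure L dst q qh qt (lastArc dst (p - 1) (dst (p - 1))) <
        searchMeasure L dst q qh qt p := by
  obtain ⟨h1, h2, h3, h4⟩ := h.scanned_advance hp
  have hpL := h.pointer_le
  refine ⟨{ h with
    pointer_le := (h.pointer_advance hp).1
    pointer := (h.pointer_advance hp).2
    closed := fun a ha h5 h6 => ?_ },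
    searchMeasure_lt_of_scan (b := p - 1) (fun a _ => h3 a) (by omega) h1 h2 (Nat.le_succ _)⟩
  rcases h4 a h6 with rfl | h7
  · exact (h.vis_iff _ ha).1 (hres (by omega))
  · exact h.closed a ha h5 h7

theorem enqueue (h : Search L src dst res t S vis q par qh qt p 0 x) (hp : p ≠ 0)
    (hres : res (p - 1) ≠ 0) (hvis : vis (src (p - 1)) = 0) {found' x' : ℕ}
    (hmiss : found' = 0 → src (p - 1) ∉ S) (hhit : found' ≠ 0 → x' = src (p - 1) ∧ src (p - 1) ∈ S) :
    Search L src dst res t S (Function.update vis (src (p - 1)) 1)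
      (Function.update q qt (src (p - 1))) (Function.update par (src (p - 1)) (p - 1)) qh (qt + 1)
      (lastArc dst (p - 1) (dst (p - 1))) found' x' ∧
      searchMeasure L dst (Function.update q qt (src (p - 1))) qh (qt + 1)
        (lastArc dst (p - 1) (dst (p - 1))) < searchMeasure L dst q qh qt p := by
  obtain ⟨h1, h2, h3, h4⟩ := h.scanned_advance hp
  obtain ⟨hp1, hp2⟩ := h.pointer hp
  have hpL : p - 1 < L := by
    have := h.pointer_le
    omega
  have hle := h.le
  have hpos := h.pos
  set w := src (p - 1) with hw
  have hnew : ∀ i < qt, q i ≠ w := fun i hi hi' =>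
    (h.vis_iff _ hpL).2 ⟨i, hi, hi'⟩ hvis
  have hq : ∀ i < qt, Function.update q qt w i = q i := fun i hi =>
    Function.update_of_ne (by omega) _ _
  have hqt : Function.update q qt w qt = w := Function.update_self _ _ _
  have hsc : ∀ p' a, Scanned dst (Function.update q qt w) qh p' a ↔ Scanned dst q qh p' a := by
    intro p' a
    refine exists_congr fun i => and_congr_right fun hi => ?_
    rw [hq i (by omega)]
  have hmem : ∀ v, (∃ i < qt + 1, Function.update q qt w i = v) ↔ v = w ∨ ∃ i < qt, q i = v := by
    intro v
    constructor
    · rintro ⟨i, hi, h5⟩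
      rcases Nat.lt_succ_iff_lt_or_eq.1 hi with h6 | rfl
      · exact Or.inr ⟨i, h6, by rw [← hq i h6, h5]⟩
      · exact Or.inl (h5.symm.trans hqt)
    · rintro (rfl | ⟨i, hi, h5⟩)
      · exact ⟨qt, by omega, hqt⟩
      · exact ⟨i, by omega, by rw [hq i hi, h5]⟩
  refine ⟨⟨?_, by omega, by omega, ?_, ?_, ?_, (h.pointer_advance hp).1, ?_, ?_, ?_, ?_⟩,
    searchMeasure_lt_of_scan (b := p - 1) (fun a _ hs => (hsc _ a).2 (h3 a hs)) hpL h1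
      ((hsc _ _).2 h2) le_rfl⟩
  · rw [hq 0 hpos, h.zero]
  · intro i hi l hl hil
    rcases Nat.lt_succ_iff_lt_or_eq.1 hi with h5 | rfl <;>
      rcases Nat.lt_succ_iff_lt_or_eq.1 hl with h6 | h6
    · rw [hq i h5, hq l h6] at hil
      exact h.inj i h5 l h6 hil
    · subst h6
      rw [hq i h5, hqt] at hil
      exact absurd hil (hnew i h5)
    · rw [hq l h6, hqt] at hil
      exact absurd hil.symm (hnew l h6)
    · exact h6.symm
  · intro a ha
    rw [hmem, Function.update_apply]
    split_ifs with h5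
    · simp [h5]
    · rw [h.vis_iff a ha]
      simp [h5]
  · intro i hi h0
    rcases Nat.lt_succ_iff_lt_or_eq.1 hi with h5 | rfl
    · obtain ⟨h6, h7, h8, l, hl, h9⟩ := h.par_spec i h5 h0
      rw [hq i h5, Function.update_of_ne (hnew i h5)]
      exact ⟨h6, h7, h8, l, hl, by rw [h9, hq l (by omega)]⟩
    · rw [hqt, Function.update_self]
      exact ⟨hpL, hw.symm, by omega, qh - 1, by omega, by rw [hp2, hq _ (by omega)]⟩
  · intro h0
    obtain ⟨h5, h6⟩ := (h.pointer_advance hp).2 h0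
    exact ⟨h5, by rw [h6, hq _ (by omega)]⟩
  · intro a ha h5 h6
    rw [hmem]
    rcases h4 a ((hsc _ a).1 h6) with rfl | h7
    · exact Or.inl hw.symm
    · exact Or.inr (h.closed a ha h5 h7)
  · intro h0 i hi
    rcases Nat.lt_succ_iff_lt_or_eq.1 hi with h5 | rfl
    · rw [hq i h5]
      exact h.miss rfl i h5
    · rw [hqt]
      exact hmiss h0
  · intro h0
    obtain ⟨rfl, h5⟩ := hhit h0
    exact ⟨qt, by omega, hqt, h5⟩

end Search

/-- The network on the edges `0, …, M - 1` with tails `src` and heads `dst`. -/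
def net (M : ℕ) (src dst : ℕ → ℕ) : Network ℕ ℕ := ⟨Finset.range M, src, dst⟩

/-- The arc `e + M` is the reverse of the edge `e`; its residual capacity is the flow on `e`. -/
structure Reversed (M : ℕ) (src dst : ℕ → ℕ) : Prop where
  src_add : ∀ e < M, src (e + M) = dst e
  dst_add : ∀ e < M, dst (e + M) = src e

/-- The arc opposite to `a`. -/
def rev (M a : ℕ) : ℕ := if a < M then a + M else a - M

/-- The residual capacities after one more unit has been sent along the arc `a`. -/
def push (M : ℕ) (res : ℕ → ℕ) (a : ℕ) : ℕ → ℕ :=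
  Function.update (Function.update res a (res a - 1)) (rev M a) (res (rev M a) + 1)

variable {M : ℕ} {src dst res : ℕ → ℕ}

theorem push_of_ne {a b : ℕ} (h1 : b ≠ a) (h2 : b ≠ rev M a) : push M res a b = res b := by
  simp [push, h1, h2]

theorem push_self {a : ℕ} (h : a ≠ rev M a) : push M res a a = res a - 1 := by
  simp [push, h]

theorem push_rev (a : ℕ) : push M res a (rev M a) = res (rev M a) + 1 := by
  simp [push]

theorem push_add_push {a e : ℕ} (ha : a < 2 * M) (hres : 0 < res a) (he : e < M) :
    push M res a e + push M res a (e + M) = res e + res (e + M) := by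
  have hne : a ≠ rev M a := by
    unfold rev
    split_ifs <;> omega
  by_cases h1 : e = a
  · subst h1
    have h2 : rev M e = e + M := if_pos he
    rw [push_self hne, ← h2, push_rev]
    omega
  · by_cases h2 : e + M = a
    · have h3 : rev M a = e := by
        unfold rev
        split_ifs <;> omega
      have h4 := push_rev (M := M) (res := res) a
      rw [h3] at h4
      rw [h4, h2, push_self hne]
      omega
    · have h3 : e ≠ rev M a := by
        unfold rev
        split_ifs <;> omega
      have h4 : e + M ≠ rev M a := by
        unfold rev
        split_ifs <;> omega
      rw [push_of_ne h1 h3, push_of_ne h2 h4]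

theorem excess_of_forall_ne {ι V : Type*} [DecidableEq V] (N : Network ι V) {g g' : ι → ℕ} {e₀ : ι}
    (he₀ : e₀ ∈ N.edges) (h : ∀ e ∈ N.edges, e ≠ e₀ → g' e = g e) (v : V) :
    N.excess g' v = N.excess g v + ((if N.head e₀ = v then (g' e₀ : ℤ) - g e₀ else 0) -
      if N.tail e₀ = v then (g' e₀ : ℤ) - g e₀ else 0) := by
  classical
  unfold Network.excess
  rw [← Finset.add_sum_erase _ _ he₀, ← Finset.add_sum_erase N.edges (fun e =>
    ((if N.head e = v then (g e : ℤ) else 0) - if N.tail e = v then (g e : ℤ) else 0)) he₀]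
  rw [Finset.sum_congr rfl fun e he => by
    rw [h e (Finset.mem_of_mem_erase he) (Finset.ne_of_mem_erase he)]]
  split_ifs <;> ring

theorem excess_push (hR : Reversed M src dst) {a : ℕ} (ha : a < 2 * M) (hres : 0 < res a) (v : ℕ) :
    (net M src dst).excess (fun e => push M res a (e + M)) v =
      (net M src dst).excess (fun e => res (e + M)) v +
        ((if dst a = v then 1 else 0) - if src a = v then 1 else 0) := by
  by_cases h : a < M
  · have h2 : rev M a = a + M := if_pos h
    rw [excess_of_forall_ne (net M src dst) (e₀ := a) (g := fun e => res (e + M))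
      (by simpa [net] using h) fun e he hea => ?_]
    · have h3 := push_rev (M := M) (res := res) a
      rw [h2] at h3
      simp [h3, net]
    · exact push_of_ne (by simp [net] at he; omega) (by omega)
  · obtain ⟨e₀, rfl⟩ : ∃ e₀, a = e₀ + M := ⟨a - M, by omega⟩
    have he₀ : e₀ < M := by omega
    have h2 : rev M (e₀ + M) = e₀ := by
      rw [rev, if_neg h]
      omega
    rw [excess_of_forall_ne (net M src dst) (e₀ := e₀) (g := fun e => res (e + M))
      (by simpa [net] using he₀) fun e he hea => ?_]
    · have h3 : ((push M res (e₀ + M) (e₀ + M) : ℕ) : ℤ) - res (e₀ + M) = -1 := by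
        rw [push_self (by omega)]
        omega
      simp only [h3, net, hR.src_add e₀ he₀, hR.dst_add e₀ he₀]
      split_ifs <;> ring
    · exact push_of_ne (by omega) (by simp [net] at he; omega)

/-- The state of an augmentation along the parent arcs of a search: one unit has been sent from the
source set to the vertex `x`, at position `i` of the queue. Here `v₀` is the flow value before. -/
structure Walk (M : ℕ) (src dst : ℕ → ℕ) (t : ℕ) (S : Set ℕ) (u : ℕ → ℕ) (v₀ : ℤ) (q par : ℕ → ℕ)
    (i x : ℕ) (res : ℕ → ℕ) : Prop where
  eq : q i = x
  par_pos : ∀ l ≤ i, 0 < l → 0 < res (par (q l))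
  cap : ∀ e < M, res e + res (e + M) = u e
  out : ∀ e < M, src e = t → res (e + M) = 0
  conserve : ∀ v, v ∉ S → v ≠ t →
    (net M src dst).excess (fun e => res (e + M)) v = if v = x then 1 else 0
  value : (net M src dst).excess (fun e => res (e + M)) t = v₀ + if x = t then 1 else 0

theorem Walk.step {t : ℕ} {S : Set ℕ} {u : ℕ → ℕ} {v₀ : ℤ} {vis q par : ℕ → ℕ}
    {qh qt p found x₀ i x : ℕ} {res₀ : ℕ → ℕ} (hR : Reversed M src dst)
    (hs : Search (2 * M) src dst res₀ t S vis q par qh qt p found x₀) (hi : i < qt)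
    (h : Walk M src dst t S u v₀ q par i x res) (hxt : x ≠ t) :
    par x < 2 * M ∧ 0 < res (par x) ∧
      ∃ l < i, Walk M src dst t S u v₀ q par l (dst (par x)) (push M res (par x)) := by
  have hi0 : 0 < i := by
    refine Nat.pos_of_ne_zero fun h0 => hxt ?_
    rw [← h.eq, h0, hs.zero]
  have hpar := hs.par_spec i hi hi0
  have hpos := h.par_pos i le_rfl hi0
  rw [h.eq] at hpar hpos
  obtain ⟨h1, h2, _, l, hl, h3⟩ := hpar
  have hfr : ∀ b < 2 * M, src (rev M b) = dst b ∧ dst (rev M b) = src b := by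
    intro b hb
    unfold rev
    split_ifs with h4
    · exact ⟨hR.src_add b h4, hR.dst_add b h4⟩
    · have h5 := hR.src_add (b - M) (by omega)
      have h6 := hR.dst_add (b - M) (by omega)
      rw [Nat.sub_add_cancel (by omega)] at h5 h6
      exact ⟨h6.symm, h5.symm⟩
  have hxl : dst (par x) ≠ x := by
    rw [h3, ← h.eq]
    exact fun h4 => hl.ne (hs.inj l (by omega) i hi h4)
  refine ⟨h1, hpos, l, hl, h3.symm, fun l' hl' h0 => ?_, fun e he => ?_, fun e he het => ?_,
    fun v hvS hvt => ?_, ?_⟩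
  · obtain ⟨h4, h5, _, l'', hl'', h6⟩ := hs.par_spec l' (by omega) h0
    rw [push_of_ne]
    · exact h.par_pos l' (by omega) h0
    · intro h7
      rw [h7, h2, ← h.eq] at h5
      have := hs.inj i hi l' (by omega) h5
      omega
    · intro h7
      rw [h7, (hfr _ h1).2, h2, ← h.eq] at h6
      have := hs.inj i hi l'' (by omega) h6
      omega
  · rw [push_add_push h1 hpos he, h.cap e he]
  · by_cases h4 : e + M = par x
    · have h5 := h.out e he het
      rw [h4] at h5
      omega
    · rw [push_of_ne h4, h.out e he het]
      intro h5
      have h6 : par x = e := by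
        unfold rev at h5
        split_ifs at h5 <;> omega
      exact hxt (by rw [← h2, h6, het])
  · rw [excess_push hR h1 hpos, h.conserve v hvS hvt, h2]
    by_cases h4 : v = x
    · subst h4
      simp [hxl, hxl.symm]
    · simp [h4, eq_comm, Ne.symm h4]
  · rw [excess_push hR h1 hpos, h.value, h2]
    simp [hxt]

end Residual

/-! ### The rounds of the computation for one target -/

namespace Residual

/-- The graph as it is stored: `m` edges among the vertices below `n`, the edge `m` from the
additional vertex `n` to the source, and after these the reversed arcs. The edge `m` gets the
capacity `lam`, so that flows from `n` are the flows from the source, capped at `lam`. -/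
structure Stored (n m : ℕ) (src dst : ℕ → ℕ) : Prop where
  reversed : Reversed (m + 1) src dst
  src_lt : ∀ e < m, src e < n
  dst_lt : ∀ e ≤ m, dst e < n
  src_eq : src m = n

/-- Unit capacities, except for the additional edge. -/
structure BaseCap (m lam : ℕ) (c : ℕ → ℕ) : Prop where
  le_one : ∀ e < m, c e ≤ 1
  eq : c m = lam

/-- The state in round `j` for the target `t`: the source set `S`, which the array `mark` marks, the
capacities `u`, and the residual capacities `res` of a flow from `S` to `t`. -/
structure Round (n m lam : ℕ) (src dst c : ℕ → ℕ) (t j : ℕ) (S : Set ℕ) (u res mark : ℕ → ℕ) :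
    Prop where
  doubling : (net (m + 1) src dst).Doubling c n t j S u
  cap : ∀ e < m + 1, res e + res (e + (m + 1)) = u e
  out : ∀ e < m + 1, src e = t → res (e + (m + 1)) = 0
  conserve : ∀ v, v ∉ S → v ≠ t →
    (net (m + 1) src dst).excess (fun e => res (e + (m + 1))) v = 0
  cut_le : (net (m + 1) src dst).cut u S ≤ lam * 2 ^ j
  cap_le : ∀ e < m + 1, u e ≤ 2 * (lam + m)
  mark_iff : ∀ a < 2 * (m + 1), mark (src a) ≠ 0 ↔ src a ∈ S

/-- The value of the flow with residual capacities `res`. -/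
noncomputable def value (m : ℕ) (src dst : ℕ → ℕ) (t : ℕ) (res : ℕ → ℕ) : ℤ :=
  (net (m + 1) src dst).excess (fun e => res (e + (m + 1))) t

/-- What the last round achieves: the edges into `t` that carry flow are a good choice. -/
structure Selects (n m lam k : ℕ) (src dst c : ℕ → ℕ) (t : ℕ) (res : ℕ → ℕ) : Prop where
  preserves : ∀ c' : ℕ → ℕ,
    (∀ e ≤ m, c' e = if e < m ∧ dst e = t then res (e + (m + 1)) else c e) →
      (net (m + 1) src dst).Preserves n k c c'
  sum_le : (∑ e ∈ Finset.range m, if dst e = t then res (e + (m + 1)) else 0) ≤ lam * 2 ^ k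

variable {n m lam k t j : ℕ} {src dst c u res mark : ℕ → ℕ} {S : Set ℕ}

theorem Stored.src_lt_two_mul (h : Stored n m src dst) {a : ℕ} (ha : a < 2 * (m + 1)) :
    ∃ e < m + 1, src a = src e ∨ src a = dst e := by
  by_cases h1 : a < m + 1
  · exact ⟨a, h1, Or.inl rfl⟩
  · have h2 := h.reversed.src_add (a - (m + 1)) (by omega)
    rw [Nat.sub_add_cancel (by omega)] at h2
    exact ⟨a - (m + 1), by omega, Or.inr h2⟩

theorem mem_edges_net {M e : ℕ} : e ∈ (net M src dst).edges ↔ e < M := by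
  simp [net]

theorem Round.start (hst : Stored n m src dst) (hc : BaseCap m lam c)
    (hres : ∀ e < m + 1, res e = c e ∧ res (e + (m + 1)) = 0)
    (hmark : ∀ a < 2 * (m + 1), mark (src a) ≠ 0 ↔ src a = n) :
    Round n m lam src dst c t 0 {n} c res mark where
  doubling := .zero
  cap e he := by rw [(hres e he).1, (hres e he).2, Nat.add_zero]
  out e he _ := (hres e he).2
  conserve v _ _ := by
    refine Finset.sum_eq_zero fun e he => ?_
    simp [(hres e (mem_edges_net.1 he)).2]
  cut_le := by
    classical
    have h1 : (net (m + 1) src dst).cut c {n} ≤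
        ∑ e ∈ Finset.range (m + 1), if e = m then lam else 0 := by
      refine Finset.sum_le_sum fun e he => ?_
      rcases Nat.lt_succ_iff_lt_or_eq.1 (Finset.mem_range.1 he) with h | rfl
      · rw [if_neg fun h2 => (hst.src_lt e h).ne h2.1]
        exact Nat.zero_le _
      · rw [if_pos rfl, ← hc.eq]
        split_ifs <;> simp
    simpa using h1
  cap_le e he := by
    rcases Nat.lt_succ_iff_lt_or_eq.1 he with h | rfl
    · have := hc.le_one e h
      omega
    · rw [hc.eq]
      omega
  mark_iff := hmark

namespace Round

theorem value_le (h : Round n m lam src dst c t j S u res mark) {Z : Set ℕ} (hSZ : S ⊆ Z)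
    (htZ : t ∉ Z) : value m src dst t res ≤ (net (m + 1) src dst).cut u Z :=
  Network.excess_le_cut _ h.conserve (fun e he => by
    rw [← h.cap e (mem_edges_net.1 he)]
    exact Nat.le_add_left _ _) hSZ htZ

theorem value_eq_sum (h : Round n m lam src dst c t j S u res mark) :
    value m src dst t res =
      ∑ e ∈ Finset.range (m + 1), if dst e = t then (res (e + (m + 1)) : ℤ) else 0 := by
  unfold value Network.excess
  refine Finset.sum_congr rfl fun e he => ?_
  have h1 := h.out e (Finset.mem_range.1 he)
  change (if dst e = t then (res (e + (m + 1)) : ℤ) else 0) -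
    (if src e = t then (res (e + (m + 1)) : ℤ) else 0) = _
  by_cases h2 : src e = t
  · simp [h2, h1 h2]
  · simp [h2]

theorem value_nonneg (h : Round n m lam src dst c t j S u res mark) :
    0 ≤ value m src dst t res := by
  rw [h.value_eq_sum]
  exact Finset.sum_nonneg fun e _ => by split_ifs <;> positivity

theorem value_le_pow (h : Round n m lam src dst c t j S u res mark) (htn : t ≠ n) :
    value m src dst t res ≤ (lam * 2 ^ j : ℕ) :=
  (h.value_le subset_rfl (h.doubling.notMem htn.symm)).trans (by exact_mod_cast h.cut_le)

theorem value_le_add (h : Round n m lam src dst c t j S u res mark)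
    (hc : BaseCap m lam c) : value m src dst t res ≤ (lam + m : ℕ) := by
  rw [h.value_eq_sum]
  have h1 : ∀ e ∈ Finset.range (m + 1), (if dst e = t then (res (e + (m + 1)) : ℤ) else 0) ≤ c e := by
    intro e he
    have he' := Finset.mem_range.1 he
    split_ifs with h2
    · rw [← h.doubling.eq_of_head_eq e (mem_edges_net.2 he') h2, ← h.cap e he']
      push_cast
      omega
    · positivity
  refine (Finset.sum_le_sum h1).trans ?_
  rw [Finset.sum_range_succ, hc.eq]
  have h2 : ∑ e ∈ Finset.range m, (c e : ℤ) ≤ ∑ _e ∈ Finset.range m, (1 : ℤ) :=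
    Finset.sum_le_sum fun e he => by exact_mod_cast hc.le_one e (Finset.mem_range.1 he)
  simp only [Finset.sum_const, Finset.card_range, nsmul_eq_mul, mul_one] at h2
  push_cast
  omega

theorem walk (h : Round n m lam src dst c t j S u res mark) (htn : t ≠ n)
    {vis q par : ℕ → ℕ} {qh qt p found x : ℕ}
    (hs : Search (2 * (m + 1)) src dst res t S vis q par qh qt p found x) (hf : found ≠ 0) :
    ∃ i < qt, Walk (m + 1) src dst t S u (value m src dst t res) q par i x res := by
  obtain ⟨i, hi, hq, hxS⟩ := hs.hit hf
  have hxt : x ≠ t := fun hxt => h.doubling.notMem htn.symm (hxt ▸ hxS)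
  refine ⟨i, hi, hq, fun l hl h0 => (hs.par_spec l (by omega) h0).2.2.1, h.cap, h.out,
    fun v hvS hvt => ?_, ?_⟩
  · rw [h.conserve v hvS hvt, if_neg fun hvx : v = x => hvS (hvx ▸ hxS)]
  · rw [if_neg hxt, add_zero, value]

theorem augment (h : Round n m lam src dst c t j S u res mark) {q par : ℕ → ℕ} {i : ℕ} {v₀ : ℤ}
    {res' : ℕ → ℕ} (hw : Walk (m + 1) src dst t S u v₀ q par i t res') :
    Round n m lam src dst c t j S u res' mark ∧ value m src dst t res' = v₀ + 1 :=
  ⟨{ h with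
      cap := hw.cap
      out := hw.out
      conserve := fun v hvS hvt => by rw [hw.conserve v hvS hvt, if_neg hvt] },
    by rw [value, hw.value, if_pos rfl]⟩

/-- The vertices in the queue of a search. -/
def found (q : ℕ → ℕ) (qt : ℕ) : Set ℕ := {v | ∃ i < qt, q i = v}

variable {vis q par : ℕ → ℕ} {qt x : ℕ}

theorem closed_of_search
    (hs : Search (2 * (m + 1)) src dst res t S vis q par qt qt 0 0 x) {a : ℕ}
    (ha : a < 2 * (m + 1)) (hres : 0 < res a) (hd : dst a ∈ found q qt) : src a ∈ found q qt := by
  obtain ⟨i, hi, h1⟩ := hd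
  exact hs.closed a ha hres ⟨i, hi, h1.symm, Or.inr (Nat.zero_le _)⟩

theorem isFarthestMinCut (h : Round n m lam src dst c t j S u res mark)
    (hst : Stored n m src dst)
    (hs : Search (2 * (m + 1)) src dst res t S vis q par qt qt 0 0 x) :
    (net (m + 1) src dst).IsFarthestMinCut u S t (found q qt)ᶜ ∧
      ((net (m + 1) src dst).cut u (found q qt)ᶜ : ℤ) = value m src dst t res := by
  refine (net (m + 1) src dst).isFarthestMinCut_compl h.conserve (fun e he => ?_) q qt
    (fun v => Iff.rfl) hs.pos hs.zero (fun i hi h0 => ?_) (fun e he hd hlt => ?_)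
    (fun e he hd hlt => ?_) fun v hvS hv => ?_
  · rw [← h.cap e (mem_edges_net.1 he)]
    exact Nat.le_add_left _ _
  · obtain ⟨h1, h2, h3, l, hl, h4⟩ := hs.par_spec i hi h0
    by_cases h5 : par (q i) < m + 1
    · refine ⟨l, hl, par (q i), mem_edges_net.2 h5, Or.inl ⟨h2, h4, ?_⟩⟩
      rw [← h.cap _ h5]
      omega
    · obtain ⟨e, he⟩ : ∃ e, par (q i) = e + (m + 1) := ⟨par (q i) - (m + 1), by omega⟩
      have he' : e < m + 1 := by omega
      rw [he] at h2 h3 h4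
      rw [hst.reversed.src_add e he'] at h2
      rw [hst.reversed.dst_add e he'] at h4
      exact ⟨l, hl, e, mem_edges_net.2 he', Or.inr ⟨h2, h4, h3⟩⟩
  · have he' := mem_edges_net.1 he
    rw [← h.cap e he'] at hlt
    exact closed_of_search hs (by omega) (by omega) hd
  · have he' := mem_edges_net.1 he
    have h1 := closed_of_search hs (a := e + (m + 1)) (by omega) hlt
    rw [hst.reversed.src_add e he', hst.reversed.dst_add e he'] at h1
    exact h1 hd
  · obtain ⟨i, hi, rfl⟩ := hv
    exact hs.miss rfl i hi hvS

theorem res_eq_zero (hs : Search (2 * (m + 1)) src dst res t S vis q par qt qt 0 0 x) {e : ℕ}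
    (he : e < m + 1) (h1 : src e ∉ found q qt) (h2 : dst e ∈ found q qt) : res e = 0 := by
  by_contra h3
  exact h1 (closed_of_search hs (by omega) (by omega) h2)

open Classical in
/-- The flow stays a flow when the saturated edges are doubled, and it keeps its value. -/
theorem advance (h : Round n m lam src dst c t j S u res mark)
    (hst : Stored n m src dst) (hc : BaseCap m lam c) (htn : t ≠ n)
    (hs : Search (2 * (m + 1)) src dst res t S vis q par qt qt 0 0 x) {res' mark' : ℕ → ℕ}
    (hres : ∀ e < m + 1, res' e =
      if src e ∉ found q qt ∧ dst e ∈ found q qt ∧ dst e ≠ t then res (e + (m + 1)) else res e)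
    (hflow : ∀ e < m + 1, res' (e + (m + 1)) = res (e + (m + 1)))
    (hmark : ∀ a < 2 * (m + 1), mark' (src a) ≠ 0 ↔ src a ∉ found q qt) :
    ∃ u', Round n m lam src dst c t (j + 1) (found q qt)ᶜ u' res' mark' ∧
      value m src dst t res' = value m src dst t res := by
  obtain ⟨hA, hval⟩ := h.isFarthestMinCut hst hs
  have hex : ∀ v, (net (m + 1) src dst).excess (fun e => res' (e + (m + 1))) v =
      (net (m + 1) src dst).excess (fun e => res (e + (m + 1))) v := fun v =>
    Finset.sum_congr rfl fun e he => by simp only [hflow e (mem_edges_net.1 he)]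
  have hle : ∀ e < m + 1, src e ∉ found q qt → dst e ∈ found q qt →
      u e ≤ (net (m + 1) src dst).cut u (found q qt)ᶜ := fun e he h1 h2 => by
    unfold Network.cut
    refine le_trans ?_ (Finset.single_le_sum (fun _ _ => Nat.zero_le _) (mem_edges_net.2 he))
    have h3 : (net (m + 1) src dst).tail e ∈ (found q qt)ᶜ ∧
        (net (m + 1) src dst).head e ∉ (found q qt)ᶜ := ⟨h1, fun h4 => h4 h2⟩
    rw [if_pos h3]
  have hadd := h.value_le_add hc
  refine ⟨fun e => if src e ∉ found q qt ∧ dst e ∈ found q qt ∧ dst e ≠ t then 2 * u e else u e,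
    ⟨h.doubling.succ hA (fun e _ h1 h2 h3 => if_pos ⟨h1, not_not.1 h2, h3⟩)
      (fun e _ h1 => if_neg fun h2 => h1 ⟨h2.1, not_not.2 h2.2.1, h2.2.2⟩), fun e he => ?_,
      fun e he h1 => ?_, fun v h1 h2 => ?_, ?_, fun e he => ?_, hmark⟩, hex t⟩
  · rw [hres e he, hflow e he]
    have h1 := h.cap e he
    split_ifs with h2
    · rw [res_eq_zero hs he h2.1 h2.2.1] at h1
      omega
    · exact h1
  · rw [hflow e he, h.out e he h1]
  · rw [hex]
    exact h.conserve v (fun h3 => h1 (hA.subset h3)) h2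
  · have h1 : (net (m + 1) src dst).cut (fun e => if src e ∉ found q qt ∧ dst e ∈ found q qt ∧
        dst e ≠ t then 2 * u e else u e) (found q qt)ᶜ ≤
        2 * (net (m + 1) src dst).cut u (found q qt)ᶜ := by
      unfold Network.cut
      rw [Finset.mul_sum]
      refine Finset.sum_le_sum fun e _ => ?_
      by_cases h2 : (net (m + 1) src dst).tail e ∈ (found q qt)ᶜ ∧
          (net (m + 1) src dst).head e ∉ (found q qt)ᶜ
      · rw [if_pos h2, if_pos h2]
        dsimp only
        split_ifs <;> omega
      · rw [if_neg h2, if_neg h2]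
        omega
    have h2 := h.value_le_pow htn
    rw [← hval] at h2
    have h3 : (net (m + 1) src dst).cut u (found q qt)ᶜ ≤ lam * 2 ^ j := by exact_mod_cast h2
    rw [pow_succ]
    calc _ ≤ _ := h1
      _ ≤ 2 * (lam * 2 ^ j) := Nat.mul_le_mul_left _ h3
      _ = _ := by ring
  · split_ifs with h1
    · have h2 := hle e he h1.1 h1.2.1
      omega
    · exact h.cap_le e he

theorem selects (h : Round n m lam src dst c t k S u res mark)
    (hst : Stored n m src dst) (htn : t ≠ n)
    (hs : Search (2 * (m + 1)) src dst res t S vis q par qt qt 0 0 x) :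
    Selects n m lam k src dst c t res := by
  obtain ⟨hA, hval⟩ := h.isFarthestMinCut hst hs
  have hcap : ∀ e < m + 1, dst e = t → res e + res (e + (m + 1)) = c e := fun e he het => by
    rw [h.cap e he, h.doubling.eq_of_head_eq e (mem_edges_net.2 he) het]
  refine ⟨fun c' hc' => h.doubling.preserves _ hA (fun e he => ?_) (fun e he h1 => ?_)
    (fun e he h1 h2 => ?_) fun Z hSZ htZ => ?_, ?_⟩
  · have he' := mem_edges_net.1 he
    rw [hc' e (by omega)]
    split_ifs with h1
    · have := hcap e he' h1.2
      omega
    · exact le_rfl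
  · rw [hc' e (by have := mem_edges_net.1 he; omega), if_neg fun h2 => h1 h2.2]
  · have he' := mem_edges_net.1 he
    rw [hc' e (by omega)]
    split_ifs with h3
    · have h4 := hcap e he' h3.2
      rw [res_eq_zero hs he' h1 (by
        rw [h3.2]
        exact ⟨0, hs.pos, hs.zero⟩)] at h4
      omega
    · rfl
  · have h1 : value m src dst t res ≤
        (net (m + 1) src dst).cut ((net (m + 1) src dst).replaceIn t c' u) Z := by
      refine Network.excess_le_cut _ h.conserve (fun e he => ?_) hSZ htZ
      have he' := mem_edges_net.1 he
      unfold Network.replaceIn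
      split_ifs with h2
      · have h3 := hcap e he' h2
        rw [hc' e (by omega)]
        split_ifs <;> omega
      · rw [← h.cap e he']
        exact Nat.le_add_left _ _
    rw [← hval] at h1
    exact_mod_cast h1
  · have h1 := h.value_le_pow htn
    rw [h.value_eq_sum, Finset.sum_range_succ] at h1
    have h2 : (0 : ℤ) ≤ if dst m = t then (res (m + (m + 1)) : ℤ) else 0 := by
      split_ifs <;> positivity
    have h3 : ((∑ e ∈ Finset.range m, if dst e = t then res (e + (m + 1)) else 0 : ℕ) : ℤ) ≤
        (lam * 2 ^ k : ℕ) := by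
      push_cast at h1 ⊢
      linarith
    exact_mod_cast h3

end Round

theorem Selects.congr {res' : ℕ → ℕ} (h : Selects n m lam k src dst c t res)
    (heq : ∀ e < m + 1, res' (e + (m + 1)) = res (e + (m + 1))) :
    Selects n m lam k src dst c t res' := by
  refine ⟨fun c' hc' => h.preserves c' fun e he => ?_, (Finset.sum_congr rfl fun e he => ?_).trans_le
    h.sum_le⟩
  · rw [hc' e he, heq e (by omega)]
  · rw [heq e (by have := Finset.mem_range.1 he; omega)]

end Residual

/-! ### The program -/

namespace WordRAM

open Program Residual

local infixr:60 ";;" => Program.seq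
local infixl:65 "⊹" => Expr.op Op.add
local infixl:65 "∸" => Expr.op Op.sub

/-- Starts with an empty queue: no vertex is visited except the target (register `6`). -/
def clearSearch : Program :=
  forTo 7 5 (.store 6 (.get 0 (.reg 7)) (.const 0) ;; .store 6 (.get 1 (.reg 7)) (.const 0)) ;;
  .store 7 (.const 0) (.reg 6) ;; .store 6 (.reg 6) (.const 1) ;;
  .assign 9 (.const 0) ;; .assign 10 (.const 1) ;; .assign 11 (.const 0) ;; .assign 12 (.const 0)

/-- Scans the arc before the pointer (register `11`), or takes a vertex out of the queue. -/
def searchStep : Program :=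
  .ite (.reg 11)
    (.assign 14 (.reg 11 ∸ .const 1) ;; .assign 11 (.get 3 (.reg 14)) ;;
      .ite (.get 5 (.reg 14))
        (.assign 15 (.get 0 (.reg 14)) ;;
          .ite (.get 6 (.reg 15)) .skip
            (.store 6 (.reg 15) (.const 1) ;; .store 8 (.reg 15) (.reg 14) ;;
              .store 7 (.reg 10) (.reg 15) ;; .assign 10 (.reg 10 ⊹ .const 1) ;;
              .ite (.get 9 (.reg 15)) (.assign 12 (.const 1) ;; .assign 13 (.reg 15)) .skip))
        .skip)
    (.assign 11 (.get 4 (.get 7 (.reg 9))) ;; .assign 9 (.reg 9 ⊹ .const 1))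

def searchLoop : Program :=
  .loop (.op .mul (.op .eq (.reg 12) (.const 0)) (.reg 11 ⊹ .op .lt (.reg 9) (.reg 10))) searchStep

/-- Sends one unit along the parent arcs from the vertex in register `13` to the target. -/
def augmentLoop : Program :=
  .loop (.op .eq (.op .eq (.reg 13) (.reg 6)) (.const 0))
    (.assign 14 (.get 8 (.reg 13)) ;;
      .store 5 (.reg 14) (.get 5 (.reg 14) ∸ .const 1) ;;
      .ite (.op .lt (.reg 14) (.reg 5)) (.assign 15 (.reg 14 ⊹ .reg 5))
        (.assign 15 (.reg 14 ∸ .reg 5)) ;;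
      .store 5 (.reg 15) (.get 5 (.reg 15) ⊹ .const 1) ;;
      .assign 13 (.get 1 (.reg 14)))

/-- Doubles the saturated edges that enter the visited part, apart from those that enter the
target, and adds the vertices that were not visited to the source set. -/
def advanceRound : Program :=
  forTo 7 5
    (.ite (.get 6 (.get 0 (.reg 7))) .skip
        (.store 9 (.get 0 (.reg 7)) (.const 1) ;;
          .ite (.get 6 (.get 1 (.reg 7)))
            (.ite (.op .eq (.get 1 (.reg 7)) (.reg 6)) .skip
              (.store 5 (.reg 7) (.get 5 (.reg 7 ⊹ .reg 5)))) .skip) ;;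
      .ite (.get 6 (.get 1 (.reg 7))) .skip (.store 9 (.get 1 (.reg 7)) (.const 1))) ;;
  .assign 8 (.reg 8 ⊹ .const 1)

/-- The zero flow, with the additional vertex as the only source. -/
def startTarget : Program :=
  forTo 7 5
    (.store 5 (.reg 7) (.get 2 (.reg 7)) ;; .store 5 (.reg 7 ⊹ .reg 5) (.const 0) ;;
      .store 9 (.get 0 (.reg 7)) (.const 0) ;; .store 9 (.get 1 (.reg 7)) (.const 0)) ;;
  .store 9 (.reg 0) (.const 1) ;; .assign 8 (.const 0)

def roundLoop : Program :=
  .loop (.op .lt (.reg 8) (.reg 4 ⊹ .const 1))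
    (clearSearch ;; searchLoop ;; .ite (.reg 12) augmentLoop advanceRound)

/-- Keeps those edges into the target that carry flow. -/
def selectEdges : Program :=
  forTo 7 1 (.ite (.op .eq (.get 1 (.reg 7)) (.reg 6))
    (.store 2 (.reg 7) (.get 5 (.reg 7 ⊹ .reg 5))) .skip)

def processTarget : Program := startTarget ;; roundLoop ;; selectEdges

/-- Adds the edge from the additional vertex to the source, of capacity `lam`. -/
def addSource : Program :=
  .assign 5 (.reg 1 ⊹ .const 1) ;; .assign 16 (.reg 5 ⊹ .reg 5) ;;
  .store 0 (.reg 1) (.reg 0) ;; .store 1 (.reg 1) (.reg 2) ;; .store 2 (.reg 1) (.reg 3)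

/-- Stores unit capacities and all reversed arcs, and links the incoming arcs of every vertex. -/
def build : Program :=
  addSource ;;
  forTo 7 1 (.store 2 (.reg 7) (.const 1)) ;;
  forTo 7 5 (.store 0 (.reg 7 ⊹ .reg 5) (.get 1 (.reg 7)) ;;
    .store 1 (.reg 7 ⊹ .reg 5) (.get 0 (.reg 7))) ;;
  forTo 7 16 (.store 3 (.reg 7) (.get 4 (.get 1 (.reg 7))) ;;
    .store 4 (.get 1 (.reg 7)) (.reg 7 ⊹ .const 1))

/-- The computation of a preserver. Registers: `0`–`4` input, `5` number of edges, `16` number of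
arcs, `6` target, `7` counter, `8` round, `9` and `10` ends of the queue, `11` pointer, `12` whether
a source was found, `13` the current vertex of an augmentation, `14` and `15` temporary. Arrays: `0`
and `1` tails and heads of the arcs, `2` base capacities, `3` and `4` linked lists, `5` residual
capacities, `6` visited vertices, `7` queue, `8` parent arcs, `9` source set. -/
def preserver : Program := .ite (.reg 1) (build ;; forTo 6 0 processTarget) .skip

/-! ### Correctness and running time -/

/-- The data that the computation for a target relies on. -/
structure Ready (W n m lam k : ℕ) (src dst : ℕ → ℕ) (σ : State) : Prop where
  stored : Stored n m src dst
  large : 16 * (n + m + lam + k + 2) ≤ W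
  reg0 : σ.reg 0 = n
  reg1 : σ.reg 1 = m
  reg4 : σ.reg 4 = k
  reg5 : σ.reg 5 = m + 1
  mem0 : σ.mem 0 = src
  mem1 : σ.mem 1 = dst
  mem3 : ∀ a < 2 * (m + 1), σ.mem 3 a = lastArc dst a (dst a)
  mem4 : ∀ v, σ.mem 4 v = lastArc dst (2 * (m + 1)) v

variable {W n m lam k t j : ℕ} {src dst c u : ℕ → ℕ} {S : Set ℕ} {σ τ : State}

theorem Ready.frame {P : Program} (h : Ready W n m lam k src dst σ) (hf : Frame P σ τ)
    (hr : (P.keepsReg 0 && P.keepsReg 1 && P.keepsReg 4 && P.keepsReg 5) = true)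
    (hm : (P.keepsMem 0 && P.keepsMem 1 && P.keepsMem 3 && P.keepsMem 4) = true) :
    Ready W n m lam k src dst τ := by
  simp only [Bool.and_eq_true] at hr hm
  obtain ⟨⟨⟨r0, r1⟩, r4⟩, r5⟩ := hr
  obtain ⟨⟨⟨m0, m1⟩, m3⟩, m4⟩ := hm
  exact ⟨h.stored, h.large, by rw [hf.reg _ r0, h.reg0], by rw [hf.reg _ r1, h.reg1],
    by rw [hf.reg _ r4, h.reg4], by rw [hf.reg _ r5, h.reg5], by rw [hf.mem _ m0, h.mem0],
    by rw [hf.mem _ m1, h.mem1], by rw [hf.mem _ m3]; exact h.mem3,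
    by rw [hf.mem _ m4]; exact h.mem4⟩

/-- The state of a search in memory. -/
def SearchAt (m : ℕ) (src dst : ℕ → ℕ) (t : ℕ) (S : Set ℕ) (σ : State) : Prop :=
  Search (2 * (m + 1)) src dst (σ.mem 5) t S (σ.mem 6) (σ.mem 7) (σ.mem 8) (σ.reg 9) (σ.reg 10)
    (σ.reg 11) (σ.reg 12) (σ.reg 13)

theorem run_clearSearch (hσ : σ.Bounded W) (hr : Ready W n m lam k src dst σ)
    (h6 : σ.reg 6 = t) (htS : t ∉ S) :
    Run W clearSearch σ (20 * (m + 1) + 30) fun τ => SearchAt m src dst t S τ ∧ τ.reg 10 = 1 := by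
  have hone := hσ.one_lt
  refine Run.mono (B := (8 + 8) * (m + 1) + 6 + 14) ?_ (by omega) fun _ h => h
  refine Run.seq hσ (Q := fun τ => ∀ e < m + 1, τ.mem 6 (src e) = 0 ∧ τ.mem 6 (dst e) = 0) ?_
    fun τ hτ hf hQ => ?_
  · have := Run.forTo (W := W) (i := 7) (n := 5)
      (P := .store 6 (.get 0 (.reg 7)) (.const 0) ;; .store 6 (.get 1 (.reg 7)) (.const 0))
      (by decide) rfl rfl hσ (B := 8)
      (fun i τ => ∀ e < i, τ.mem 6 (src e) = 0 ∧ τ.mem 6 (dst e) = 0) (fun e he => by omega) ?_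
    · rwa [hr.reg5] at this
    · intro i hi τ hτ hreg hmem hi7 hI
      refine (Run.of_wp hτ ?_).mono (B := 8) le_rfl fun _ h => h
      have h0 : τ.mem 0 = src := by rw [hmem 0 rfl, hr.mem0]
      have h1 : τ.mem 1 = dst := by rw [hmem 1 rfl, hr.mem1]
      simp [Program.wp, Expr.eval, Expr.Safe, h0, h1, hi7, hone.trans' Nat.zero_lt_one]
      intro e he
      rcases Nat.lt_or_eq_of_le he with h | rfl
      · simp [Function.update_apply, hI e h]
      · simp [Function.update_apply]
  · have hr' := hr.frame hf rfl rfl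
    have h6' : τ.reg 6 = t := by rw [hf.reg 6 rfl, h6]
    refine (Run.of_wp hτ ?_).mono (B := 14) le_rfl fun _ h => h
    simp [Program.wp, Expr.eval, Expr.Safe, h6', hone, hone.trans' Nat.zero_lt_one, SearchAt]
    refine Search.start _ _ htS (by simp) fun a ha => ?_
    obtain ⟨e, he, h | h⟩ := hr.stored.src_lt_two_mul ha
    · rw [h, Function.update_apply, (hQ e he).1]
      simp
    · rw [h, Function.update_apply, (hQ e he).2]
      simp

theorem run_searchStep (hσ : σ.Bounded W) (hr : Ready W n m lam k src dst σ)
    (hmark : ∀ a < 2 * (m + 1), σ.mem 9 (src a) ≠ 0 ↔ src a ∈ S) (hs : SearchAt m src dst t S σ)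
    (hf : σ.reg 12 = 0) (hgo : σ.reg 11 ≠ 0 ∨ σ.reg 9 < σ.reg 10) :
    Run W searchStep σ 60 fun τ => SearchAt m src dst t S τ ∧
      searchMeasure (2 * (m + 1)) dst (τ.mem 7) (τ.reg 9) (τ.reg 10) (τ.reg 11) <
        searchMeasure (2 * (m + 1)) dst (σ.mem 7) (σ.reg 9) (σ.reg 10) (σ.reg 11) := by
  have hW := hr.large
  have hqt := hs.le_succ
  have hp := hs.pointer_le
  have hs' := hs
  unfold SearchAt at hs
  rw [hf] at hs
  refine (Run.of_wp hσ ?_).mono (by decide) fun _ h => h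
  refine ⟨trivial, fun h11 => ?_, fun h11 => ?_⟩
  · replace h11 : σ.reg 11 ≠ 0 := h11
    have hpL : σ.reg 11 - 1 < 2 * (m + 1) := by omega
    have hm := hr.mem3 _ hpL
    by_cases hres : σ.mem 5 (σ.reg 11 - 1) = 0
    · obtain ⟨h1, h2⟩ := hs.skip h11 fun h => absurd hres h
      simp [Program.wp, Expr.eval, Expr.Safe, Op.Safe, Op.app, hres, hm, hσ.one_lt, SearchAt, hf]
      exact ⟨h1, h2⟩
    by_cases hvis : σ.mem 6 (src (σ.reg 11 - 1)) = 0
    · by_cases hS : σ.mem 9 (src (σ.reg 11 - 1)) = 0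
      · obtain ⟨h1, h2⟩ := hs.enqueue h11 hres hvis (found' := 0) (x' := σ.reg 13)
          (fun _ h => (hmark _ hpL).2 h hS) (fun h => absurd rfl h)
        simp [Program.wp, Expr.eval, Expr.Safe, Op.Safe, Op.app, hres, hm, hσ.one_lt, SearchAt, hf,
          hr.mem0, hvis, hS]
        exact ⟨by omega, h1, h2⟩
      · obtain ⟨h1, h2⟩ := hs.enqueue h11 hres hvis (found' := 1) (x' := src (σ.reg 11 - 1))
          (fun h => absurd h one_ne_zero) (fun _ => ⟨rfl, (hmark _ hpL).1 hS⟩)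
        simp [Program.wp, Expr.eval, Expr.Safe, Op.Safe, Op.app, hres, hm, hσ.one_lt, SearchAt, hf,
          hr.mem0, hvis, hS]
        exact ⟨by omega, h1, h2⟩
    · obtain ⟨h1, h2⟩ := hs.skip h11 fun _ => hvis
      simp [Program.wp, Expr.eval, Expr.Safe, Op.Safe, Op.app, hres, hm, hσ.one_lt, SearchAt, hf,
        hr.mem0, hvis]
      exact ⟨h1, h2⟩
  · replace h11 : σ.reg 11 = 0 := h11
    have hlt : σ.reg 9 < σ.reg 10 := hgo.resolve_left fun h => h h11
    rw [h11] at hs ⊢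
    obtain ⟨h1, h2⟩ := hs.dequeue hlt
    simp [Program.wp, Expr.eval, Expr.Safe, Op.Safe, Op.app, hr.mem4, hσ.one_lt, SearchAt, hf]
    exact ⟨by omega, h1, h2⟩

theorem run_searchLoop (hσ : σ.Bounded W) (hr : Ready W n m lam k src dst σ)
    (hmark : ∀ a < 2 * (m + 1), σ.mem 9 (src a) ≠ 0 ↔ src a ∈ S) (hs : SearchAt m src dst t S σ)
    (h10 : σ.reg 10 = 1) :
    Run W searchLoop σ (400 * (m + 1)) fun τ => SearchAt m src dst t S τ ∧
      (τ.reg 12 = 0 → τ.reg 11 = 0 ∧ τ.reg 9 = τ.reg 10) := by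
  have hW := hr.large
  refine (Run.loop (B := 60) hσ (fun μ τ => SearchAt m src dst t S τ ∧
    μ = searchMeasure (2 * (m + 1)) dst (τ.mem 7) (τ.reg 9) (τ.reg 10) (τ.reg 11)) _ ⟨hs, rfl⟩
    fun μ τ hτ hf hI => ?_).mono ?_ ?_
  · obtain ⟨hs', rfl⟩ := hI
    have hp := hs'.pointer_le
    refine ⟨?_, fun hb => ?_⟩
    · simp only [Expr.Safe, Op.Safe, Expr.eval, Op.app]
      refine ⟨⟨trivial, by omega, trivial⟩, ⟨trivial, ⟨trivial, trivial, trivial⟩, ?_⟩, ?_⟩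
      · by_cases h2 : τ.reg 9 < τ.reg 10 <;> simp only [h2, if_true, if_false] <;> omega
      · by_cases h1 : τ.reg 12 = 0 <;> by_cases h2 : τ.reg 9 < τ.reg 10 <;>
          simp only [h1, h2, if_true, if_false] <;> omega
    · have hcond : τ.reg 12 = 0 ∧ (τ.reg 11 ≠ 0 ∨ τ.reg 9 < τ.reg 10) := by
        simp only [Expr.eval, Op.app] at hb
        by_cases h1 : τ.reg 12 = 0 <;> by_cases h2 : τ.reg 9 < τ.reg 10 <;> simp_all
      refine (run_searchStep hτ (hr.frame hf rfl rfl) (fun a ha => ?_) hs' hcond.1 hcond.2).mono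
        le_rfl fun ρ hρ => ⟨_, hρ.2, hρ.1, rfl⟩
      rw [hf.mem 9 rfl]
      exact hmark a ha
  · have h1 := searchMeasure_le (2 * (m + 1)) dst (σ.mem 7) (σ.reg 9) (σ.reg 10) (σ.reg 11)
    rw [h10] at h1 ⊢
    simp only [Expr.cost]
    omega
  · rintro τ ⟨⟨μ, hs', -⟩, hb⟩
    refine ⟨hs', fun h12 => ?_⟩
    simp only [Expr.eval, Op.app, h12] at hb
    have := hs'.le
    split_ifs at hb <;> simp_all
    omega

theorem run_augmentLoop (hσ : σ.Bounded W) (hr : Ready W n m lam k src dst σ) (htn : t ≠ n)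
    (h6 : σ.reg 6 = t) (hround : Round n m lam src dst c t j S u (σ.mem 5) (σ.mem 9))
    (hs : SearchAt m src dst t S σ) (h12 : σ.reg 12 ≠ 0) :
    Run W augmentLoop σ (150 * (m + 1)) fun τ =>
      Round n m lam src dst c t j S u (τ.mem 5) (τ.mem 9) ∧
      value m src dst t (τ.mem 5) = value m src dst t (σ.mem 5) + 1 := by
  have hW := hr.large
  have hR := hr.stored.reversed
  obtain ⟨i, hi, hwalk⟩ := hround.walk htn hs h12
  refine ((Run.loop (B := 30) hσ (fun μ τ => μ < σ.reg 10 ∧ Walk (m + 1) src dst t S u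
    (value m src dst t (σ.mem 5)) (σ.mem 7) (σ.mem 8) μ (τ.reg 13) (τ.mem 5)) _ ⟨hi, hwalk⟩
    fun μ τ hτ hf hI => ?_).frame hσ).mono ?_ ?_
  · obtain ⟨hμ, hw⟩ := hI
    have hr' := hr.frame hf rfl rfl
    have h6' : τ.reg 6 = t := by rw [hf.reg 6 rfl, h6]
    refine ⟨⟨⟨trivial, trivial, trivial⟩, by show 0 < W; omega, trivial⟩, fun hb => ?_⟩
    have hxt : τ.reg 13 ≠ t := by
      rintro hxt
      simp [Expr.eval, Op.app, h6', hxt] at hb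
    obtain ⟨h1, h2, l, hl, hstep⟩ := hw.step hR hs hμ hxt
    have ha : τ.mem 8 (τ.reg 13) = σ.mem 8 (τ.reg 13) := by rw [hf.mem 8 rfl]
    set a := σ.mem 8 (τ.reg 13)
    have hrev : rev (m + 1) a < 2 * (m + 1) ∧ rev (m + 1) a ≠ a := by
      unfold rev
      split_ifs <;> omega
    have hbound : τ.mem 5 (rev (m + 1) a) ≤ 2 * (lam + m) := by
      by_cases h3 : rev (m + 1) a < m + 1
      · have h4 := hw.cap _ h3
        have h5 := hround.cap_le _ h3
        omega
      · have h4 := hw.cap (rev (m + 1) a - (m + 1)) (by omega)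
        have h5 := hround.cap_le (rev (m + 1) a - (m + 1)) (by omega)
        rw [Nat.sub_add_cancel (by omega)] at h4
        omega
    have hI : l < μ ∧ l < σ.reg 10 ∧ Walk (m + 1) src dst t S u
        (value m src dst t (σ.mem 5)) (σ.mem 7) (σ.mem 8) l (dst a) (push (m + 1) (τ.mem 5) a) :=
      ⟨hl, hl.trans hμ, hstep⟩
    refine (Run.of_wp hτ ?_).mono (by decide) fun ρ hρ => ⟨l, hρ⟩
    by_cases ham : a < m + 1
    · have hra : rev (m + 1) a = a + (m + 1) := if_pos ham
      simp only [push, hra] at hI hbound hrev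
      simp [Program.wp, Expr.eval, Expr.Safe, Op.Safe, Op.app, hr'.reg5, hr'.mem1, ha, ham,
        hτ.one_lt]
      exact ⟨by omega, by omega, hI⟩
    · have hra : rev (m + 1) a = a - (m + 1) := if_neg ham
      simp only [push, hra] at hI hbound hrev
      simp [Program.wp, Expr.eval, Expr.Safe, Op.Safe, Op.app, hr'.reg5, hr'.mem1, ha, ham,
        hrev.2, hτ.one_lt]
      exact ⟨by omega, hI⟩
  · have h1 := hs.le_succ
    simp only [Expr.cost]
    omega
  · rintro τ ⟨-, hf, ⟨μ, -, hw⟩, hb⟩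
    have hxt : τ.reg 13 = t := by
      by_contra hxt
      simp [Expr.eval, Op.app, hf.reg 6 rfl, h6, hxt] at hb
    rw [hxt] at hw
    rw [hf.mem 9 rfl]
    exact hround.augment hw

open Classical in
theorem run_advanceRound (hσ : σ.Bounded W) (hr : Ready W n m lam k src dst σ) (htn : t ≠ n)
    (h6 : σ.reg 6 = t) (h8 : σ.reg 8 ≤ k) (hc : BaseCap m lam c)
    (hround : Round n m lam src dst c t j S u (σ.mem 5) (σ.mem 9))
    (hs : SearchAt m src dst t S σ) (h12 : σ.reg 12 = 0) (h11 : σ.reg 11 = 0)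
    (h9 : σ.reg 9 = σ.reg 10) :
    Run W advanceRound σ (60 * (m + 1) + 20) fun τ => τ.reg 8 = σ.reg 8 + 1 ∧
      (∀ e < m + 1, τ.mem 5 (e + (m + 1)) = σ.mem 5 (e + (m + 1))) ∧
      ∃ S' u', Round n m lam src dst c t (j + 1) S' u' (τ.mem 5) (τ.mem 9) ∧
      value m src dst t (τ.mem 5) = value m src dst t (σ.mem 5) := by
  have hW := hr.large
  have hst := hr.stored
  have hone := hσ.one_lt
  set vis := σ.mem 6 with hvis
  set res := σ.mem 5 with hres
  set mark := σ.mem 9 with hmark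
  let I : ℕ → State → Prop := fun i τ =>
    (∀ e < m + 1, τ.mem 5 e = if e < i ∧ vis (src e) = 0 ∧ vis (dst e) ≠ 0 ∧ dst e ≠ t then
      res (e + (m + 1)) else res e) ∧
    (∀ e < m + 1, τ.mem 5 (e + (m + 1)) = res (e + (m + 1))) ∧
    (∀ v, τ.mem 9 v ≠ 0 → mark v ≠ 0 ∨ vis v = 0) ∧ (∀ v, mark v ≠ 0 → τ.mem 9 v ≠ 0) ∧
    ∀ e < i, (vis (src e) = 0 → τ.mem 9 (src e) ≠ 0) ∧ (vis (dst e) = 0 → τ.mem 9 (dst e) ≠ 0)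
  have hloop := Run.forTo (W := W) (i := 7) (n := 5) (P :=
    (.ite (.get 6 (.get 0 (.reg 7))) .skip
        (.store 9 (.get 0 (.reg 7)) (.const 1) ;;
          .ite (.get 6 (.get 1 (.reg 7)))
            (.ite (.op .eq (.get 1 (.reg 7)) (.reg 6)) .skip
              (.store 5 (.reg 7) (.get 5 (.reg 7 ⊹ .reg 5)))) .skip) ;;
      .ite (.get 6 (.get 1 (.reg 7))) .skip (.store 9 (.get 1 (.reg 7)) (.const 1))))
      (by decide) rfl rfl hσ (B := 45) I ?_ ?_
  · rw [hr.reg5] at hloop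
    refine (hloop.seq hσ (R := _) (B' := 4) fun τ hτ hf hI => ?_).mono ?_ fun _ h => h
    · have hr' := hr.frame hf rfl rfl
      have h8' : τ.reg 8 = σ.reg 8 := hf.reg 8 rfl
      obtain ⟨h1, h2, h3, h4, h5⟩ := hI
      refine (Run.of_wp (P := .assign 8 (.reg 8 ⊹ .const 1)) hτ ?_).mono le_rfl fun _ h => h
      simp only [Program.wp, Expr.eval, Expr.Safe, Op.Safe, Op.app, State.setReg_reg_self,
        State.setReg_mem, true_and, h8', hone]
      refine ⟨by omega, h2, ?_⟩
      unfold SearchAt at hs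
      rw [h12, h11, h9] at hs
      have hfound : ∀ a < 2 * (m + 1), vis (src a) ≠ 0 ↔ src a ∈ Round.found (σ.mem 7) (σ.reg 10) :=
        hs.vis_iff
      have hv0 : ∀ e < m + 1, vis (src e) = 0 ↔ src e ∉ Round.found (σ.mem 7) (σ.reg 10) :=
        fun e he => by rw [← hfound e (by omega), not_not]
      have hv1 : ∀ e < m + 1, vis (dst e) = 0 ↔ dst e ∉ Round.found (σ.mem 7) (σ.reg 10) :=
        fun e he => by
          have := hfound (e + (m + 1)) (by omega)
          rw [hst.reversed.src_add e he] at this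
          rw [← this, not_not]
      obtain ⟨u', h6, h7⟩ := hround.advance hst hc htn hs (res' := τ.mem 5) (mark' := τ.mem 9)
        (fun e he => by
          rw [h1 e he]
          simp only [he, true_and, ne_eq, hv0 e he, hv1 e he, not_not]) h2 (fun a ha => by
          rw [← not_iff_not.2 (hfound a ha), not_not]
          refine ⟨fun h => (h3 _ h).elim (fun h' => ?_) id, fun h => ?_⟩
          · by_contra hne
            obtain ⟨l, hl, hql⟩ := (hfound a ha).1 hne
            exact hs.miss rfl l hl (hql ▸ (hround.mark_iff a ha).1 h')
          · obtain ⟨e, he, h' | h'⟩ := hst.src_lt_two_mul ha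
            · rw [h'] at h ⊢
              exact (h5 e he).1 h
            · rw [h'] at h ⊢
              exact (h5 e he).2 h)
      exact ⟨_, u', h6, h7⟩
    · omega
  · refine ⟨fun e he => ?_, fun e _ => rfl, fun v h => Or.inl h, fun v h => h, fun e he => by omega⟩
    simp [hres]
  · intro i hi τ hτ hreg hmem hi7 hI
    rw [hr.reg5] at hi
    refine (Run.of_wp hτ ?_).mono (by decide) fun _ h => h
    have h0 : τ.mem 0 = src := by rw [hmem 0 rfl, hr.mem0]
    have h1 : τ.mem 1 = dst := by rw [hmem 1 rfl, hr.mem1]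
    have h5 : τ.reg 5 = m + 1 := by rw [hreg 5 (by decide) rfl, hr.reg5]
    have h6 : τ.reg 6 = t := by rw [hreg 6 (by decide) rfl, h6]
    have hv : τ.mem 6 = vis := hmem 6 rfl
    obtain ⟨I1, I2, I3, I4, I5⟩ := hI
    have hsafe : i + (m + 1) < W := by omega
    simp [Program.wp, Expr.eval, Expr.Safe, Op.Safe, Op.app, h0, h1, h5, h6, hi7, hv, hone, hsafe, I]
    clear_value vis res mark
    clear hs hround hσ hr hst hreg hmem I hτ
    repeat' first | apply And.intro | intro _
    all_goals grind

end WordRAM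

/-! ### The computation for one target -/

namespace WordRAM

open Program Residual

variable {W n m lam k t j : ℕ} {src dst c u : ℕ → ℕ} {S : Set ℕ} {σ τ : State}

theorem run_startTarget (hσ : σ.Bounded W) (hr : Ready W n m lam k src dst σ)
    (hc : BaseCap m lam (σ.mem 2)) :
    Run W startTarget σ (40 * (m + 1) + 20) fun τ => τ.reg 8 = 0 ∧
      Round n m lam src dst (σ.mem 2) t 0 {n} (σ.mem 2) (τ.mem 5) (τ.mem 9) := by
  have hone := hσ.one_lt
  have hW := hr.large
  let I : ℕ → State → Prop := fun i τ =>
    (∀ e < i, τ.mem 5 e = σ.mem 2 e ∧ τ.mem 5 (e + (m + 1)) = 0) ∧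
    ∀ e < i, τ.mem 9 (src e) = 0 ∧ τ.mem 9 (dst e) = 0
  refine Run.mono (Run.seq hσ (Run.forTo (by decide) rfl rfl hσ I
    ⟨fun e he => by omega, fun e he => by omega⟩ fun i hi τ hτ hreg hmem hi7 hI =>
      (Run.of_wp hτ ?_)) (B' := 6) fun τ hτ hf hI => ?_) ?_ fun _ h => h
  · rw [hr.reg5] at hi
    have h0 : τ.mem 0 = src := by rw [hmem 0 rfl, hr.mem0]
    have h1 : τ.mem 1 = dst := by rw [hmem 1 rfl, hr.mem1]
    have h2 : τ.mem 2 = σ.mem 2 := hmem 2 rfl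
    have h5 : τ.reg 5 = m + 1 := by rw [hreg 5 (by decide) rfl, hr.reg5]
    have hsafe : i + (m + 1) < W := by omega
    obtain ⟨I1, I2⟩ := hI
    simp [Program.wp, Expr.eval, Expr.Safe, Op.Safe, Op.app, h0, h1, h2, h5, hi7, hsafe, I,
      hone.trans' Nat.zero_lt_one]
    clear hmem hreg I
    constructor <;> intro e he <;> constructor <;> grind
  · rw [hr.reg5] at hI
    have h0 : τ.reg 0 = n := by rw [hf.reg 0 rfl, hr.reg0]
    refine Run.mono (Run.of_wp hτ ?_) (by decide) fun _ h => h
    simp [Program.wp, Expr.eval, Expr.Safe, hone, h0, hone.trans' Nat.zero_lt_one]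
    refine Round.start hr.stored hc hI.1 fun a ha => ?_
    obtain ⟨e, he, h | h⟩ := hr.stored.src_lt_two_mul ha
    · rw [h, Function.update_apply, (hI.2 e he).1]
      simp
    · rw [h, Function.update_apply, (hI.2 e he).2]
      simp
  · rw [hr.reg5]
    simp only [Program.cost, Expr.cost]
    omega

theorem run_roundLoop (hσ : σ.Bounded W) (hr : Ready W n m lam k src dst σ) (htn : t ≠ n)
    (h6 : σ.reg 6 = t) (hc : BaseCap m lam c) (h8 : σ.reg 8 = 0)
    (hround : Round n m lam src dst c t 0 S u (σ.mem 5) (σ.mem 9)) :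
    Run W roundLoop σ (700 * (m + 1) * (lam * 2 ^ k + (k + 1)) + 6) fun τ =>
      Selects n m lam k src dst c t (τ.mem 5) := by
  have hW := hr.large
  have hone := hσ.one_lt
  -- Every iteration raises the flow value by one or ends a round.
  let I : ℕ → State → Prop := fun μ τ =>
    (τ.reg 8 ≤ k ∧ ∃ S u, Round n m lam src dst c t (τ.reg 8) S u (τ.mem 5) (τ.mem 9) ∧
      μ = (lam * 2 ^ k - (value m src dst t (τ.mem 5)).toNat) + (k + 1 - τ.reg 8)) ∨
    (τ.reg 8 = k + 1 ∧ Selects n m lam k src dst c t (τ.mem 5))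
  have hI0 : I ((lam * 2 ^ k - (value m src dst t (σ.mem 5)).toNat) + (k + 1)) σ := by
    refine Or.inl ⟨by omega, S, u, ?_, ?_⟩
    · rw [h8]
      exact hround
    · rw [h8]
      omega
  obtain ⟨B, hB⟩ : ∃ B, 700 * (m + 1) = B + 6 := ⟨700 * (m + 1) - 6, by omega⟩
  refine Run.mono (Run.frame hσ (Run.loop (B := B) hσ I _ hI0 fun μ τ hτ hf hI => ?_)) ?_ ?_
  · have hr' := hr.frame hf rfl rfl
    have h6' : τ.reg 6 = t := by rw [hf.reg 6 rfl, h6]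
    have h4' : τ.reg 4 = k := hr'.reg4
    refine ⟨⟨trivial, ⟨trivial, hone, ?_⟩, trivial⟩, fun hb => ?_⟩
    · change τ.reg 4 + 1 < W
      omega
    have hlt : τ.reg 8 < k + 1 := by
      by_contra hcon
      simp [Expr.eval, Op.app, h4', hcon] at hb
    rcases hI with ⟨hle, S, u, hround, rfl⟩ | ⟨h, -⟩
    swap
    · omega
    have htS : t ∉ S := hround.doubling.notMem htn.symm
    refine Run.mono (Run.seq hτ (run_clearSearch hτ hr' h6' htS) fun τ₁ hτ₁ hf₁ h₁ =>
      Run.seq hτ₁ (run_searchLoop hτ₁ (hr'.frame hf₁ rfl rfl) (fun a ha => ?_) h₁.1 h₁.2)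
        fun τ₂ hτ₂ hf₂ h₂ => Run.ite hτ₂ trivial (fun h12 => ?_) fun h12 => ?_)
      (B := (20 * (m + 1) + 30) + (400 * (m + 1) + (1 + 1 + (150 * (m + 1) +
        (60 * (m + 1) + 20))))) (by omega) fun _ h => h
    · rw [hf₁.mem 9 rfl]
      exact hround.mark_iff a ha
    all_goals
      have hr₂ := (hr'.frame hf₁ rfl rfl).frame hf₂ rfl rfl
      have h6₂ : τ₂.reg 6 = t := by rw [hf₂.reg 6 rfl, hf₁.reg 6 rfl, h6']
      have h8₂ : τ₂.reg 8 = τ.reg 8 := by rw [hf₂.reg 8 rfl, hf₁.reg 8 rfl]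
      have h5₂ : τ₂.mem 5 = τ.mem 5 := by rw [hf₂.mem 5 rfl, hf₁.mem 5 rfl]
      have h9₂ : τ₂.mem 9 = τ.mem 9 := by rw [hf₂.mem 9 rfl, hf₁.mem 9 rfl]
      have hround₂ : Round n m lam src dst c t (τ.reg 8) S u (τ₂.mem 5) (τ₂.mem 9) := by
        rw [h5₂, h9₂]
        exact hround
      have hpow : lam * 2 ^ τ.reg 8 ≤ lam * 2 ^ k :=
        Nat.mul_le_mul_left _ (Nat.pow_le_pow_right Nat.two_pos hle)
    · refine Run.mono (Run.frame hτ₂ (run_augmentLoop hτ₂ hr₂ htn h6₂ hround₂ h₂.1 h12)) le_rfl ?_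
      rintro ρ ⟨-, hfρ, h3, h4⟩
      have h8ρ : ρ.reg 8 = τ.reg 8 := by rw [hfρ.reg 8 rfl, h8₂]
      have h5 := h3.value_le_pow htn
      have h6 := hround.value_nonneg
      refine ⟨_, ?_, Or.inl ⟨by omega, S, u, by rwa [h8ρ], rfl⟩⟩
      rw [h5₂] at h4
      zify at hpow
      push_cast at h5
      have h7 : (value m src dst t (ρ.mem 5)).toNat = (value m src dst t (τ.mem 5)).toNat + 1 := by
        omega
      have h9 : (value m src dst t (ρ.mem 5)).toNat ≤ lam * 2 ^ k := by
        zify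
        rw [Int.toNat_of_nonneg (by omega)]
        exact h5.trans hpow
      omega
    · obtain ⟨h11, h9⟩ := h₂.2 h12
      refine Run.mono (run_advanceRound hτ₂ hr₂ htn h6₂ (by omega) hc hround₂ h₂.1 h12 h11 h9)
        le_rfl ?_
      rintro ρ ⟨h8ρ, hflow, S', u', h3, h4⟩
      rw [h8₂] at h8ρ
      rw [h5₂] at h4
      by_cases hlast : τ.reg 8 = k
      · refine ⟨0, by omega, Or.inr ⟨by omega, ?_⟩⟩
        have hs := h₂.1
        unfold SearchAt at hs
        rw [show τ₂.reg 12 = 0 from h12, h11, h9] at hs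
        rw [hlast] at hround₂
        exact (hround₂.selects hr.stored htn hs).congr hflow
      · refine ⟨_, ?_, Or.inl ⟨by omega, S', u', by rwa [h8ρ], rfl⟩⟩
        rw [h4, h8ρ]
        omega
  · have h1 : (lam * 2 ^ k - (value m src dst t (σ.mem 5)).toNat) + (k + 1) ≤
        lam * 2 ^ k + (k + 1) := by omega
    have h2 := Nat.mul_le_mul_left (B + 6) h1
    rw [hB]
    simp only [Expr.cost]
    rw [show 1 + (1 + 1 + 1) + 1 + 1 + B = B + 6 by omega]
    omega
  · rintro τ ⟨-, hf, ⟨μ, hI⟩, hb⟩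
    rcases hI with ⟨hle, -⟩ | ⟨-, h⟩
    · have h4 : τ.reg 4 = k := by rw [hf.reg 4 rfl, hr.reg4]
      simp only [Expr.eval, Op.app, h4] at hb
      rw [if_pos (by omega)] at hb
      exact absurd hb one_ne_zero
    · exact h

theorem run_selectEdges (hσ : σ.Bounded W) (hr : Ready W n m lam k src dst σ) (h6 : σ.reg 6 = t) :
    Run W selectEdges σ (30 * (m + 1)) fun τ => ∀ e ≤ m, τ.mem 2 e =
      if e < m ∧ dst e = t then σ.mem 5 (e + (m + 1)) else σ.mem 2 e := by
  have hone := hσ.one_lt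
  have hW := hr.large
  refine Run.mono (Run.forTo (by decide) rfl rfl hσ (fun i τ => ∀ e ≤ m, τ.mem 2 e =
      if e < i ∧ dst e = t then σ.mem 5 (e + (m + 1)) else σ.mem 2 e)
    (fun e he => by simp) fun i hi τ hτ hreg hmem hi7 hI => Run.of_wp hτ ?_) ?_ fun τ h => ?_
  · rw [hr.reg1] at hi
    have h1 : τ.mem 1 = dst := by rw [hmem 1 rfl, hr.mem1]
    have h5 : τ.mem 5 = σ.mem 5 := hmem 5 rfl
    have h5' : τ.reg 5 = m + 1 := by rw [hreg 5 (by decide) rfl, hr.reg5]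
    have h6' : τ.reg 6 = t := by rw [hreg 6 (by decide) rfl, h6]
    have hsafe : i + (m + 1) < W := by omega
    simp [Program.wp, Expr.eval, Expr.Safe, Op.Safe, Op.app, h1, h5, h5', h6', hi7, hsafe]
    clear hmem hreg
    constructor <;> intros <;> grind
  · rw [hr.reg1]
    simp only [Program.cost, Expr.cost]
    omega
  · rwa [hr.reg1] at h

theorem run_processTarget (hσ : σ.Bounded W) (hr : Ready W n m lam k src dst σ) (htn : t ≠ n)
    (h6 : σ.reg 6 = t) (hc : BaseCap m lam (σ.mem 2)) :
    Run W processTarget σ (800 * (m + 1) * (lam * 2 ^ k + (k + 1))) fun τ =>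
      (net (m + 1) src dst).Preserves n k (σ.mem 2) (τ.mem 2) ∧ BaseCap m lam (τ.mem 2) ∧
      (∑ e ∈ Finset.range m, if dst e = t then τ.mem 2 e else 0) ≤ lam * 2 ^ k := by
  refine Run.mono (Run.seq hσ (run_startTarget hσ hr hc) fun τ₁ hτ₁ hf₁ h₁ =>
    Run.seq hτ₁ (run_roundLoop hτ₁ (hr.frame hf₁ rfl rfl) htn (hf₁.reg 6 rfl |>.trans h6) hc h₁.1
      h₁.2) fun τ₂ hτ₂ hf₂ h₂ => Run.mono (run_selectEdges hτ₂
        ((hr.frame hf₁ rfl rfl).frame hf₂ rfl rfl)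
        ((hf₂.reg 6 rfl).trans (hf₁.reg 6 rfl |>.trans h6))) le_rfl fun τ h => ?_) ?_ fun _ h => h
  · have h2 : τ₂.mem 2 = σ.mem 2 := (hf₂.mem 2 rfl).trans (hf₁.mem 2 rfl)
    rw [h2] at h
    have hp := h₂.preserves (τ.mem 2) h
    refine ⟨hp, ⟨fun e he => (hp.le e (mem_edges_net.2 (by omega))).trans (hc.le_one e he), ?_⟩, ?_⟩
    · rw [h m le_rfl, if_neg fun h => lt_irrefl _ h.1, hc.eq]
    · refine (Finset.sum_congr rfl fun e he => ?_).trans_le h₂.sum_le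
      have he' := Finset.mem_range.1 he
      by_cases hd : dst e = t
      · rw [if_pos hd, if_pos hd, h e he'.le, if_pos ⟨he', hd⟩]
      · rw [if_neg hd, if_neg hd]
  · have h1 : 100 * (m + 1) * 1 ≤ 100 * (m + 1) * (lam * 2 ^ k + (k + 1)) :=
      Nat.mul_le_mul_left _ (by omega)
    have h2 : 800 * (m + 1) * (lam * 2 ^ k + (k + 1)) = 700 * (m + 1) * (lam * 2 ^ k + (k + 1)) +
      100 * (m + 1) * (lam * 2 ^ k + (k + 1)) := by ring
    rw [h2]
    omega

end WordRAM

/-! ### The whole computation and its output -/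

namespace WordRAM

open Program Residual

variable {W n m lam k s t j : ℕ} {src dst c u : ℕ → ℕ} {S : Set ℕ} {σ τ : State}

/-- What the computation assumes about the initial state. -/
structure IsInput (W n m lam k s : ℕ) (σ : State) : Prop where
  large : 16 * (n + m + lam + k + 2) ≤ W
  reg0 : σ.reg 0 = n
  reg1 : σ.reg 1 = m
  reg2 : σ.reg 2 = s
  reg3 : σ.reg 3 = lam
  reg4 : σ.reg 4 = k
  lt : s < n
  mem0 : ∀ e < m, σ.mem 0 e < n
  mem1 : ∀ e < m, σ.mem 1 e < n
  mem4 : ∀ v, σ.mem 4 v = 0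

/-- The arrays `src` and `dst` extend the input by the edge from the additional vertex. -/
structure Extends (n m s : ℕ) (σ : State) (src dst : ℕ → ℕ) : Prop where
  src_eq : ∀ e < m, src e = σ.mem 0 e
  dst_eq : ∀ e < m, dst e = σ.mem 1 e
  src_last : src m = n
  dst_last : dst m = s

theorem run_addSource (hσ : σ.Bounded W) (h : IsInput W n m lam k s σ) :
    Run W addSource σ 30 fun τ => τ.reg 5 = m + 1 ∧ τ.reg 16 = 2 * (m + 1) ∧
      Extends n m s σ (τ.mem 0) (τ.mem 1) ∧ τ.mem 2 m = lam := by
  have hW := h.large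
  refine Run.mono (Run.of_wp hσ ?_) (by decide) fun _ h => h
  simp [addSource, Program.wp, Expr.eval, Expr.Safe, Op.Safe, Op.app, h.reg0, h.reg1, h.reg2, h.reg3,
    hσ.one_lt]
  refine ⟨by omega, by omega, by omega, ?_, ?_, ?_, ?_⟩
  · intro e he
    exact Function.update_of_ne he.ne _ _
  · intro e he
    exact Function.update_of_ne he.ne _ _
  · simp
  · simp

theorem run_build (hσ : σ.Bounded W) (h : IsInput W n m lam k s σ) :
    Run W build σ (120 * (m + 1)) fun τ => ∃ src dst, Ready W n m lam k src dst τ ∧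
      Extends n m s σ src dst ∧ (∀ e < m, τ.mem 2 e = 1) ∧ τ.mem 2 m = lam := by
  have hW := h.large
  have hone := hσ.one_lt
  refine Run.mono (Run.seq hσ (run_addSource hσ h) (B' := 11 * m + 58 * (m + 1) + 18)
    fun τ₁ hτ₁ hf₁ h₁ => ?_) (by omega) fun _ h => h
  have hr1 : τ₁.reg 1 = m := by rw [hf₁.reg 1 rfl, h.reg1]
  refine Run.mono (Run.seq hτ₁ (Run.forTo (i := 7) (n := 1) (by decide) rfl rfl hτ₁
    (fun i τ => (∀ e < i, τ.mem 2 e = 1) ∧ τ.mem 2 m = lam) ⟨fun e he => by omega, h₁.2.2.2⟩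
    fun i hi τ hτ hreg hmem hi7 hI => Run.of_wp hτ ?_) (B' := 58 * (m + 1) + 12)
    fun τ₂ hτ₂ hf₂ h₂ => ?_) ?_ fun _ h => h
  · rw [hr1] at hi
    simp [Program.wp, Expr.eval, Expr.Safe, hi7, hone]
    clear hreg hmem
    constructor <;> intros <;> grind
  · have hr5 : τ₂.reg 5 = m + 1 := by rw [hf₂.reg 5 rfl, h₁.1]
    refine Run.mono (Run.seq hτ₂ (Run.forTo (i := 7) (n := 5) (by decide) rfl rfl hτ₂ (fun i τ =>
      (∀ e < m + 1, τ.mem 0 e = τ₁.mem 0 e ∧ τ.mem 1 e = τ₁.mem 1 e) ∧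
      ∀ e < i, τ.mem 0 (e + (m + 1)) = τ₁.mem 1 e ∧ τ.mem 1 (e + (m + 1)) = τ₁.mem 0 e)
      ⟨fun e _ => ⟨by rw [State.setReg_mem, hf₂.mem 0 rfl], by rw [State.setReg_mem, hf₂.mem 1 rfl]⟩,
        fun e he => by omega⟩ fun i hi τ hτ hreg hmem hi7 hI => Run.of_wp hτ ?_)
      (B' := 38 * (m + 1) + 6) fun τ₃ hτ₃ hf₃ h₃ => ?_) ?_ fun _ h => h
    · have hr5' : τ.reg 5 = m + 1 := by rw [hreg 5 (by decide) rfl, hr5]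
      rw [hr5] at hi
      have hsafe : i + (m + 1) < W := by omega
      simp [Program.wp, Expr.eval, Expr.Safe, Op.Safe, Op.app, hi7, hr5', hsafe]
      clear hreg hmem
      constructor <;> intros <;> grind
    swap
    · rw [hr5]
      simp only [Program.cost, Expr.cost]
      omega
    have hr16 : τ₃.reg 16 = 2 * (m + 1) := by rw [hf₃.reg 16 rfl, hf₂.reg 16 rfl, h₁.2.1]
    refine Run.mono (Run.frame hτ₃ (Run.forTo (i := 7) (n := 16) (by decide) rfl rfl hτ₃ (fun i τ =>
      (∀ a < i, τ.mem 3 a = lastArc (τ₃.mem 1) a (τ₃.mem 1 a)) ∧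
      ∀ v, τ.mem 4 v = lastArc (τ₃.mem 1) i v)
      ⟨fun e he => by omega, fun v => by
        rw [State.setReg_mem, hf₃.mem 4 rfl, hf₂.mem 4 rfl, hf₁.mem 4 rfl, h.mem4, lastArc]⟩
      fun i hi τ hτ hreg hmem hi7 hI => Run.of_wp hτ ?_)) ?_ ?_
    · have hm1 : τ.mem 1 = τ₃.mem 1 := hmem 1 rfl
      rw [hr16] at hi
      have hsafe : i + 1 < W := by omega
      simp [Program.wp, Expr.eval, Expr.Safe, Op.Safe, Op.app, hi7, hm1, hsafe, hone, lastArc]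
      clear hreg hmem
      constructor <;> intros <;> grind
    · rw [hr16]
      simp only [Program.cost, Expr.cost]
      omega
    rintro τ ⟨hb, hf₄, h₄, h₅⟩
    rw [hr16] at h₄ h₅
    rw [hr5] at h₃
    rw [hr1] at h₂
    have hE := h₁.2.2.1
    obtain ⟨h₃a, h₃b⟩ := h₃
    have h2 : τ.mem 2 = τ₂.mem 2 := (hf₄.mem 2 rfl).trans (hf₃.mem 2 rfl)
    refine ⟨τ₃.mem 0, τ₃.mem 1, ⟨⟨⟨fun e he => ?_, fun e he => ?_⟩, fun e he => ?_, fun e he => ?_,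
      ?_⟩, hW, ?_, ?_, ?_, ?_, hf₄.mem 0 rfl, hf₄.mem 1 rfl, h₄, h₅⟩,
      ⟨fun e he => ?_, fun e he => ?_, ?_, ?_⟩, ?_, ?_⟩
    · rw [(h₃b e he).1, (h₃a e he).2]
    · rw [(h₃b e he).2, (h₃a e he).1]
    · rw [(h₃a e (by omega)).1, hE.src_eq e he]
      exact h.mem0 e he
    · rw [(h₃a e (by omega)).2]
      rcases Nat.lt_or_eq_of_le he with h' | rfl
      · rw [hE.dst_eq e h']
        exact h.mem1 e h'
      · rw [hE.dst_last]
        exact h.lt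
    · rw [(h₃a m (by omega)).1, hE.src_last]
    · rw [hf₄.reg 0 rfl, hf₃.reg 0 rfl, hf₂.reg 0 rfl, hf₁.reg 0 rfl, h.reg0]
    · rw [hf₄.reg 1 rfl, hf₃.reg 1 rfl, hf₂.reg 1 rfl, hf₁.reg 1 rfl, h.reg1]
    · rw [hf₄.reg 4 rfl, hf₃.reg 4 rfl, hf₂.reg 4 rfl, hf₁.reg 4 rfl, h.reg4]
    · rw [hf₄.reg 5 rfl, hf₃.reg 5 rfl, hf₂.reg 5 rfl, h₁.1]
    · rw [(h₃a e (by omega)).1, hE.src_eq e he]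
    · rw [(h₃a e (by omega)).2, hE.dst_eq e he]
    · rw [(h₃a m (by omega)).1, hE.src_last]
    · rw [(h₃a m (by omega)).2, hE.dst_last]
    · rw [h2]
      exact h₂.1
    · rw [h2]
      exact h₂.2
  · rw [hr1]
    simp only [Program.cost, Expr.cost]
    omega

theorem run_preserver (hσ : σ.Bounded W) (h : IsInput W n m lam k s σ) (hm : 0 < m)
    (hlam : 0 < lam) :
    Run W preserver σ (4000 * (lam * 2 ^ k * m * n)) fun τ => ∃ src dst c,
      Extends n m s σ src dst ∧ (∀ e < m, c e = 1) ∧ c m = lam ∧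
      (net (m + 1) src dst).Preserves n k c (τ.mem 2) ∧
      ∀ t < n, (∑ e ∈ Finset.range m, if dst e = t then τ.mem 2 e else 0) ≤ lam * 2 ^ k := by
  have hn : 0 < n := (Nat.zero_le s).trans_lt h.lt
  refine Run.mono (Run.ite hσ trivial (fun _ => Run.seq hσ (run_build hσ h) fun τ hτ hf hQ => ?_)
    fun h0 => ?_) (B := 1 + 1 + ((120 * (m + 1) +
      ((800 * (m + 1) * (lam * 2 ^ k + (k + 1)) + 8) * n + 6)) + 0)) ?_ fun _ h => h
  · obtain ⟨src, dst, hr, hE, hc, hcm⟩ := hQ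
    refine Run.mono (Run.forTo (B := 800 * (m + 1) * (lam * 2 ^ k + (k + 1))) (by decide) rfl rfl hτ
      (fun i ρ => Ready W n m lam k src dst ρ ∧ BaseCap m lam (ρ.mem 2) ∧
        (net (m + 1) src dst).Preserves n k (τ.mem 2) (ρ.mem 2) ∧
        ∀ t < i, (∑ e ∈ Finset.range m, if dst e = t then ρ.mem 2 e else 0) ≤ lam * 2 ^ k)
      ⟨?_, ⟨fun e he => (hc e he).le, hcm⟩, .refl _ _ _, fun t ht => by omega⟩
      fun i hi ρ hρ hreg hmem hi7 hI => ?_) ?_ fun ρ hI => ?_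
    · exact hr.frame (P := .assign 6 (.const 0)) ⟨fun x hx => State.setReg_reg_of_ne _ _ (by
        simpa [Program.keepsReg] using hx), fun _ _ => rfl⟩ rfl rfl
    · obtain ⟨hr', hc', hp, hsum⟩ := hI
      rw [hr.reg0] at hi
      refine Run.mono (Run.frame hρ (run_processTarget hρ hr' hi.ne hi7 hc')) le_rfl ?_
      rintro ρ' ⟨-, hf', hp', hc'', hsum'⟩
      refine ⟨(hr'.frame hf' rfl rfl).frame (P := .assign 6 (.const 0))
        ⟨fun x hx => State.setReg_reg_of_ne _ _ (by simpa [Program.keepsReg] using hx),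
          fun _ _ => rfl⟩ rfl rfl, hc'', hp.trans hp', fun t ht => ?_⟩
      rcases Nat.lt_succ_iff_lt_or_eq.1 ht with ht' | rfl
      · refine (Finset.sum_le_sum fun e he => ?_).trans (hsum t ht')
        have := hp'.le e (mem_edges_net.2 (by have := Finset.mem_range.1 he; omega))
        rw [State.setReg_mem]
        split_ifs <;> omega
      · exact hsum'
    · rw [hr.reg0]
    · rw [hr.reg0] at hI
      exact ⟨src, dst, τ.mem 2, hE, hc, hcm, hI.2.2.1, hI.2.2.2⟩
  · exact absurd (h.reg1.symm.trans h0) hm.ne'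
  · have hk : k + 1 ≤ lam * 2 ^ k := by
      have h1 : k < 2 ^ k := Nat.lt_two_pow_self
      have h2 : 1 * 2 ^ k ≤ lam * 2 ^ k := Nat.mul_le_mul_right _ hlam
      omega
    generalize hp : lam * 2 ^ k = p at *
    have hp1 : 1 ≤ p := by omega
    obtain ⟨m', rfl⟩ : ∃ m', m = m' + 1 := ⟨m - 1, by omega⟩
    obtain ⟨n', rfl⟩ : ∃ n', n = n' + 1 := ⟨n - 1, by omega⟩
    have h1 : 800 * (m' + 1 + 1) * (p + (k + 1)) ≤ 3200 * (p * (m' + 1)) := by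
      calc 800 * (m' + 1 + 1) * (p + (k + 1)) ≤ 800 * (2 * (m' + 1)) * (2 * p) :=
            Nat.mul_le_mul (by omega) (by omega)
        _ = 3200 * (p * (m' + 1)) := by ring
    have h2 : 800 * (m' + 1 + 1) * (p + (k + 1)) * (n' + 1) ≤ 3200 * (p * (m' + 1) * (n' + 1)) := by
      calc _ ≤ 3200 * (p * (m' + 1)) * (n' + 1) := Nat.mul_le_mul_right _ h1
        _ = _ := by ring
    have h3 : m' + 1 ≤ p * (m' + 1) * (n' + 1) := by
      calc m' + 1 = 1 * (m' + 1) * 1 := by ring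
        _ ≤ _ := Nat.mul_le_mul (Nat.mul_le_mul_right _ hp1) (by omega)
    have h4 : n' + 1 ≤ p * (m' + 1) * (n' + 1) := by
      calc n' + 1 = 1 * (n' + 1) := by ring
        _ ≤ _ := Nat.mul_le_mul_right _ (Nat.mul_pos hp1 (Nat.succ_pos _))
    rw [Nat.add_mul]
    omega

/-! ### The preserver of a directed graph -/

variable {V : Type*} [Fintype V] {G : Digraph V}

/-- The subgraph of `G` whose edges are those with a non-zero mark. -/
def markedGraph (edg : Fin G.edges.card ≃ G.edges) (c : ℕ → ℕ) : Digraph V where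
  Adj u v := ∃ i : Fin G.edges.card, (edg i).1 = (u, v) ∧ c i ≠ 0

theorem markedGraph_eq_self (edg : Fin G.edges.card ≃ G.edges) {c : ℕ → ℕ}
    (hc : ∀ e < G.edges.card, c e = 1) : markedGraph edg c = G := by
  ext u v
  constructor
  · rintro ⟨i, hi, -⟩
    have := Digraph.mem_edges.1 (edg i).2
    rwa [hi] at this
  · intro h
    refine ⟨edg.symm ⟨(u, v), Digraph.mem_edges.2 h⟩, by simp, ?_⟩
    rw [hc _ (Fin.is_lt _)]
    exact one_ne_zero

theorem markedGraph_le (edg : Fin G.edges.card ≃ G.edges) (c : ℕ → ℕ) : markedGraph edg c ≤ G := by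
  rintro u v ⟨i, hi, -⟩
  have := Digraph.mem_edges.1 (edg i).2
  rwa [hi] at this

open Classical in
theorem cutSize_markedGraph (edg : Fin G.edges.card ≃ G.edges) (c : ℕ → ℕ) (F : Finset (V × V))
    (A : Set V) : ((markedGraph edg c).deleteEdges F).cutSize A =
      ∑ i : Fin G.edges.card, if (edg i).1.1 ∈ A ∧ (edg i).1.2 ∉ A ∧ (edg i).1 ∉ F ∧ c i ≠ 0
        then 1 else 0 := by
  rw [← Finset.card_filter, Digraph.cutSize]
  symm
  refine Finset.card_bij (fun i _ => (edg i).1) (fun i hi => ?_) (fun i _ l _ hil => ?_)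
    fun e he => ?_
  · simp only [Finset.mem_filter, Finset.mem_univ, true_and] at hi
    exact Finset.mem_filter.2 ⟨Digraph.mem_edges.2 ⟨⟨i, rfl, hi.2.2.2⟩, hi.2.2.1⟩, hi.1, hi.2.1⟩
  · exact edg.injective (Subtype.ext hil)
  · obtain ⟨h1, h2, h3⟩ := Finset.mem_filter.1 he
    obtain ⟨⟨i, hi, hci⟩, hF⟩ := Digraph.mem_edges.1 h1
    have hi' : (edg i).1 = e := hi
    exact ⟨i, by simp only [Finset.mem_filter, Finset.mem_univ, true_and, hi']; exact ⟨h2, h3, hF, hci⟩,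
      hi'⟩

theorem inDegree_markedGraph_le (edg : Fin G.edges.card ≃ G.edges) (c : ℕ → ℕ) (v : V)
    [DecidableEq V] : (markedGraph edg c).inDegree v ≤
      ∑ i : Fin G.edges.card, if (edg i).1.2 = v then c i else 0 := by
  classical
  have h1 : (markedGraph edg c).inDegree v ≤
      ((Finset.univ.filter fun i => (edg i).1.2 = v ∧ c i ≠ 0).image fun i => (edg i).1.1).card := by
    refine Finset.card_le_card fun u hu => ?_
    obtain ⟨i, hi, hci⟩ := (Finset.mem_filter.1 hu).2
    exact Finset.mem_image.2 ⟨i, by simp [hi, hci], by simp [hi]⟩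
  refine h1.trans (Finset.card_image_le.trans ?_)
  rw [Finset.card_filter]
  refine Finset.sum_le_sum fun i _ => ?_
  by_cases h2 : (edg i).1.2 = v <;> by_cases h3 : c i = 0 <;> simp [h2, h3]
  omega

/-- Preservation of cuts in the stored network, where the source is replaced by the additional
vertex, amounts to preservation of bounded flows. -/
theorem isFTBFP_markedGraph {s : V} {lam k : ℕ} (vtx : V ≃ Fin (Fintype.card V))
    (edg : Fin G.edges.card ≃ G.edges) {src dst c c' : ℕ → ℕ}
    (hsrc : ∀ i : Fin G.edges.card, src i = vtx (edg i).1.1)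
    (hdst : ∀ i : Fin G.edges.card, dst i = vtx (edg i).1.2)
    (hsrc' : src G.edges.card = Fintype.card V) (hdst' : dst G.edges.card = vtx s)
    (hc : ∀ e < G.edges.card, c e = 1) (hcm : c G.edges.card = lam)
    (h : (net (G.edges.card + 1) src dst).Preserves (Fintype.card V) k c c') :
    Digraph.IsFTBFP lam k G s (markedGraph edg c') := by
  classical
  refine Digraph.isFTBFP_of_cutSize (markedGraph_le edg c') fun F hF hk A hsA => ?_
  let F' : Finset ℕ := (Finset.univ.filter fun i : Fin G.edges.card => (edg i).1 ∈ F).image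
    fun i : Fin G.edges.card => (i : ℕ)
  have hF' : ∀ i : Fin G.edges.card, (i : ℕ) ∈ F' ↔ (edg i).1 ∈ F := by
    intro i
    simp only [F', Finset.mem_image, Finset.mem_filter, Finset.mem_univ, true_and]
    exact ⟨fun ⟨l, hl, hli⟩ => Fin.ext hli ▸ hl, fun hi => ⟨i, hi, rfl⟩⟩
  have hF'lt : ∀ e ∈ F', e < G.edges.card := by
    intro e he
    obtain ⟨i, -, rfl⟩ := Finset.mem_image.1 he
    exact i.is_lt
  have hcard : F'.card ≤ k := by
    refine (Finset.card_image_le.trans (Finset.card_le_card_of_injOn (fun i => (edg i).1)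
      (fun i hi => ?_) fun i _ l _ hil => edg.injective (Subtype.ext hil))).trans hk
    simpa using hi
  let X : Set ℕ := {v | v = Fintype.card V ∨ ∃ a ∈ A, (vtx a : ℕ) = v}
  have hX : ∀ a : V, (vtx a : ℕ) ∈ X ↔ a ∈ A := by
    intro a
    constructor
    · rintro (h1 | ⟨b, hb, h1⟩)
      · exact absurd h1 (vtx a).is_lt.ne
      · exact vtx.injective (Fin.ext h1) ▸ hb
    · exact fun ha => Or.inr ⟨a, ha, rfl⟩
  obtain ⟨X', hX'X, hnX', hle⟩ := h.exists_cut_le F'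
    (fun e he => mem_edges_net.2 (by have := hF'lt e he; omega))
    (fun e he => (hc e (hF'lt e he)).le) hcard X (Or.inl rfl)
  have hcutX : (net (G.edges.card + 1) src dst).cut (Network.del F' c') X ≤
      ((markedGraph edg c').deleteEdges F).cutSize A := by
    rw [cutSize_markedGraph, Network.cut]
    change ∑ e ∈ Finset.range (G.edges.card + 1), _ ≤ _
    rw [Finset.sum_range_succ, if_neg fun h1 => h1.2 (by
      change dst G.edges.card ∈ X
      rw [hdst', hX]
      exact hsA), add_zero, Finset.sum_range]
    refine Finset.sum_le_sum fun i _ => ?_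
    have h1 := h.le i (mem_edges_net.2 (by omega))
    rw [hc i i.is_lt] at h1
    simp only [net, hsrc, hdst, hX, Network.del, hF']
    by_cases h2 : (edg i).1.1 ∈ A <;> by_cases h3 : (edg i).1.2 ∈ A <;>
      by_cases h4 : (edg i).1 ∈ F <;> by_cases h5 : c' i = 0 <;> simp [h2, h3, h4, h5, h1]
  -- If the source is not in `X'`, then `X'` cuts the additional edge, of capacity `lam`.
  by_cases hs : (vtx s : ℕ) ∈ X'
  · refine Or.inr ⟨{a | (vtx a : ℕ) ∈ X'}, fun a ha => (hX a).1 (hX'X ha), hs, ?_⟩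
    refine le_trans ?_ (hle.trans hcutX)
    have h0 := cutSize_markedGraph edg c F {a | (vtx a : ℕ) ∈ X'}
    rw [markedGraph_eq_self edg hc] at h0
    rw [h0, Network.cut]
    change _ ≤ ∑ e ∈ Finset.range (G.edges.card + 1), (_ : ℕ)
    rw [Finset.sum_range_succ, Finset.sum_range]
    refine Nat.le_add_right_of_le (Finset.sum_le_sum fun i _ => ?_)
    simp only [net, hsrc, hdst, Network.del, hF', hc i i.is_lt, Set.mem_ofPred_eq]
    by_cases h2 : (vtx (edg i).1.1 : ℕ) ∈ X' <;> by_cases h3 : (vtx (edg i).1.2 : ℕ) ∈ X' <;>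
      by_cases h4 : (edg i).1 ∈ F <;> simp [h2, h3, h4]
  · refine Or.inl (le_trans ?_ (hle.trans hcutX))
    unfold Network.cut
    refine le_trans ?_ (Finset.single_le_sum (fun _ _ => Nat.zero_le _)
      (mem_edges_net.2 (Nat.lt_succ_self G.edges.card)))
    have h1 : G.edges.card ∉ F' := fun h1 => lt_irrefl _ (hF'lt G.edges.card h1)
    rw [if_pos ⟨by change src G.edges.card ∈ X'; rwa [hsrc'], by change dst G.edges.card ∉ X'; rwa [hdst']⟩, Network.del,
      if_neg h1, hcm]

theorem isInput_inputState (s : V) {lam k : ℕ} (vtx : V ≃ Fin (Fintype.card V))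
    (edg : Fin G.edges.card ≃ G.edges) {W : ℕ}
    (hW : 16 * (Fintype.card V + G.edges.card + lam + k + 2) ≤ W) :
    IsInput W (Fintype.card V) G.edges.card lam k (vtx s) (inputState G s lam k vtx edg) where
  large := hW
  reg0 := rfl
  reg1 := rfl
  reg2 := rfl
  reg3 := rfl
  reg4 := rfl
  lt := (vtx s).is_lt
  mem0 e he := by simp [inputState, he]
  mem1 e he := by simp [inputState, he]
  mem4 v := by simp [inputState]

theorem bounded_inputState (s : V) {lam k : ℕ} (vtx : V ≃ Fin (Fintype.card V))
    (edg : Fin G.edges.card ≃ G.edges) {W : ℕ}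
    (hW : 16 * (Fintype.card V + G.edges.card + lam + k + 2) ≤ W) :
    (inputState G s lam k vtx edg).Bounded W := by
  have hlt : ∀ v, (vtx v : ℕ) < W := fun v => (vtx v).is_lt.trans (by omega)
  refine ⟨by omega, fun x => ?_, fun a i => ?_⟩
  · match x with
    | 0 | 1 | 3 | 4 => simp only [inputState]; omega
    | 2 => exact hlt s
    | _ + 5 => simp only [inputState]; omega
  · simp only [inputState]
    split_ifs
    · match a with
      | 0 | 1 => exact hlt _
      | _ + 2 => simp only; omega
    · omega

end WordRAM

theorem theorem1 :
    ∃ (P : WordRAM.Program) (C c : ℕ),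
      ∀ (V : Type*) [Fintype V] (G : Digraph V) (s : V) (lam k : ℕ), 1 ≤ lam → 1 ≤ k →
      ∀ (vtx : V ≃ Fin (Fintype.card V)) (edg : Fin G.edges.card ≃ G.edges),
        ∃ (τ : WordRAM.State) (T : ℕ),
          WordRAM.Exec ((Fintype.card V + G.edges.card + lam + k + 2) ^ c) P
            (WordRAM.inputState G s lam k vtx edg) τ T ∧
          T ≤ C * (lam * 2 ^ k * G.edges.card * Fintype.card V + 1) ∧
          Digraph.IsFTBFP lam k G s (WordRAM.outputGraph G edg τ) ∧
          (∀ v : V, (WordRAM.outputGraph G edg τ).inDegree v ≤ 2 ^ k * lam) ∧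
          (WordRAM.outputGraph G edg τ).edges.card ≤ lam * 2 ^ k * Fintype.card V := by
  classical
  refine ⟨WordRAM.preserver, 4000, 3, fun V _ G s lam k hlam hk vtx edg => ?_⟩
  -- The largest words are residual capacities and arc numbers, both linear in the input size.
  have hW : 16 * (Fintype.card V + G.edges.card + lam + k + 2) ≤
      (Fintype.card V + G.edges.card + lam + k + 2) ^ 3 := by
    have h4 : 4 ≤ Fintype.card V + G.edges.card + lam + k + 2 := by omega
    calc _ = 4 * 4 * (Fintype.card V + G.edges.card + lam + k + 2) := by ring
      _ ≤ _ := Nat.mul_le_mul_right _ (Nat.mul_le_mul h4 h4)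
      _ = _ := by ring
  have hI := WordRAM.isInput_inputState s vtx edg hW
  have hB := WordRAM.bounded_inputState s vtx edg hW
  -- It remains to bound the in-degrees; these bound the number of edges.
  suffices h : ∃ (τ : WordRAM.State) (T : ℕ),
      WordRAM.Exec ((Fintype.card V + G.edges.card + lam + k + 2) ^ 3) WordRAM.preserver
        (WordRAM.inputState G s lam k vtx edg) τ T ∧
      T ≤ 4000 * (lam * 2 ^ k * G.edges.card * Fintype.card V + 1) ∧
      Digraph.IsFTBFP lam k G s (WordRAM.markedGraph edg (τ.mem 2)) ∧
      ∀ v : V, (WordRAM.markedGraph edg (τ.mem 2)).inDegree v ≤ lam * 2 ^ k by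
    obtain ⟨τ, T, h1, h2, h3, h4⟩ := h
    exact ⟨τ, T, h1, h2, h3, fun v => (h4 v).trans (mul_comm _ _).le, Digraph.card_edges_le h4⟩
  rcases Nat.eq_zero_or_pos G.edges.card with hm | hm
  · refine ⟨_, _, .ite_false (hB.reg_lt 1) (hI.reg1.trans hm) (.skip _), ?_, ?_, fun v => ?_⟩
    · simp only [WordRAM.Expr.cost]
      omega
    · rw [WordRAM.markedGraph_eq_self edg fun e he => by omega]
      refine ⟨fun _ _ h => h, fun F _ _ t => ⟨fun _ => rfl, fun h => h.le⟩⟩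
    · refine (WordRAM.inDegree_markedGraph_le edg _ v).trans ?_
      rw [Finset.sum_eq_zero fun i _ => absurd i.is_lt (by omega)]
      exact Nat.zero_le _
  · obtain ⟨τ, T, h1, h2, src, dst, c, hE, hc, hcm, hp, hsum⟩ :=
      WordRAM.run_preserver hB hI hm hlam
    have hsrc : ∀ i : Fin G.edges.card, src i = vtx (edg i).1.1 := fun i => by
      rw [hE.src_eq i i.is_lt]
      simp [WordRAM.inputState]
    have hdst : ∀ i : Fin G.edges.card, dst i = vtx (edg i).1.2 := fun i => by
      rw [hE.dst_eq i i.is_lt]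
      simp [WordRAM.inputState]
    refine ⟨τ, T, h1, h2.trans (Nat.mul_le_mul_left _ (Nat.le_succ _)),
      WordRAM.isFTBFP_markedGraph vtx edg hsrc hdst hE.src_last hE.dst_last hc hcm hp, fun v => ?_⟩
    refine (WordRAM.inDegree_markedGraph_le edg _ v).trans (le_trans ?_ (hsum _ (vtx v).is_lt))
    rw [Finset.sum_range]
    refine Finset.sum_le_sum fun i _ => ?_
    rw [hdst i]
    by_cases h3 : (edg i).1.2 = v
    · rw [if_pos h3, if_pos (by rw [h3])]
    · rw [if_neg h3]
      exact Nat.zero_le _
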